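/- Let $n\ge 2$. Let $B_n$ be the hyperoctahedral group, i.e. the group of permutations $w$ of $\{\pm1,\dots,\pm n\}$ with $w(-i)=-w(i)$ for all $i$, with simple reflections $s_0=(1\ {-1})$ and $s_i=(i\ \ i{+}1)({-i}\ \ {-(i{+}1)})$ for $1\le i\le n-1$. Let $T$ be the set of all conjugates of simple reflections, let $\ell_T(w)$ be the least number of factors in an expression of $w$ as a product of elements of $T$, and let $\le_T$ be the absolute order: $u\le_T v$ if and only if $\ell_T(v)=\ell_T(u)+\ell_T(u^{-1}v)$. Let $c$ be a Coxeter element of $B_n$ (a product, in some order, of all the simple reflections, each taken once), and let $NC(B_n,c)=\{w: e\le_T w\le_T c\}$, which is a lattice under $\le_T$. For $w\in B_n$ let $\pi_T(w)$ be the join in $NC(B_n,c)$ of all $t\in T$ with $t\le_T w$, and let $\mathrm{Pop}_T(w)=w\cdot\pi_T(w)^{-1}$. Then the number of elements $w\in B_n$ that require exactly $2n-2$ or exactly $2n-1$ iterations of $\mathrm{Pop}_T$ to reach the identity (that is, for which the least $k\ge 0$ with $\mathrm{Pop}_T^k(w)=e$ is $2n-2$ or $2n-1$) is $2^n-n$.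 -/

import Mathlib

namespace PopTsack

section Dual

variable {W : Type*} [Group W]

/-- The set `T` of reflections of `(W, S)`: the closure of `S` under conjugation. -/
def reflections (S : Set W) : Set W :=
  {t | ∃ w : W, ∃ s ∈ S, t = w * s * w⁻¹}

/-- The absolute (reflection) length `ℓ_T(w)`: the least number of factors in an expression of `w`
as a product of reflections. -/
noncomputable def absLength (S : Set W) (w : W) : ℕ :=
  sInf {k | ∃ l : List W, (∀ t ∈ l, t ∈ reflections S) ∧ l.length = k ∧ l.prod = w}

/-- The absolute order: `u ≤_T v` if and only if `ℓ_T(v) = ℓ_T(u) + ℓ_T(u⁻¹ v)`. -/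
def AbsLE (S : Set W) (u v : W) : Prop :=
  absLength S v = absLength S u + absLength S (u⁻¹ * v)

/-- The noncrossing partitions `NC(W, c)`: the interval `[e, c]` of the absolute order. -/
def noncrossing (S : Set W) (c : W) : Set W :=
  {w | AbsLE S 1 w ∧ AbsLE S w c}

/-- `v` is the join of the set `A` in the poset `NC(W, c)`, i.e. its least upper bound there. -/
def IsNCJoin (S : Set W) (c : W) (A : Set W) (v : W) : Prop :=
  v ∈ noncrossing S c ∧ (∀ a ∈ A, AbsLE S a v) ∧
    ∀ u ∈ noncrossing S c, (∀ a ∈ A, AbsLE S a u) → AbsLE S v u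

/-- The reflections lying below `w` in the absolute order. -/
def reflectionsBelow (S : Set W) (w : W) : Set W :=
  {t | t ∈ reflections S ∧ AbsLE S t w}

open Classical in
/-- The noncrossing projection `π_T(w)`: the join in `NC(W, c)` of all reflections `t ≤_T w`.
(For a finite Coxeter group and a Coxeter element `c` the poset `NC(W, c)` is a lattice, so this
join exists and the value `1` in the other case is never taken.) -/
noncomputable def ncProj (S : Set W) (c w : W) : W :=
  if h : ∃ v, IsNCJoin S c (reflectionsBelow S w) v then h.choose else 1

/-- The Coxeter pop-tsack torsing operator `Pop_T(w) = w · π_T(w)⁻¹`. -/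
noncomputable def popT (S : Set W) (c w : W) : W :=
  w * (ncProj S c w)⁻¹

/-- `w` requires exactly `k` iterations of `Pop_T` to reach the identity. -/
def RequiresExactly (S : Set W) (c w : W) (k : ℕ) : Prop :=
  IsLeast {m : ℕ | (popT S c)^[m] w = 1} k

end Dual

section TypeB

/-- The set `±[n]`: `(i, false)` stands for the number `i + 1` and `(i, true)` for its
negative. -/
abbrev SignedPoint (n : ℕ) : Type := Fin n × Bool

/-- Negation on `±[n]`. -/
def bar {n : ℕ} (x : SignedPoint n) : SignedPoint n := (x.1, !x.2)

/-- The hyperoctahedral group `B_n`: the permutations `w` of `±[n]` with `w(-x) = -w(x)`. -/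
def Hyperoctahedral (n : ℕ) : Subgroup (Equiv.Perm (SignedPoint n)) where
  carrier := {w | ∀ x, w (bar x) = bar (w x)}
  one_mem' := fun _ => rfl
  mul_mem' := by
    intro a b ha hb x
    change ∀ x, a (bar x) = bar (a x) at ha
    change ∀ x, b (bar x) = bar (b x) at hb
    change (a * b) (bar x) = bar ((a * b) x)
    rw [Equiv.Perm.mul_apply, Equiv.Perm.mul_apply, hb, ha]
  inv_mem' := by
    intro a ha x
    change ∀ x, a (bar x) = bar (a x) at ha
    change a⁻¹ (bar x) = bar (a⁻¹ x)
    rw [Equiv.Perm.inv_eq_iff_eq, ha]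
    simp

/-- The signed permutation induced by a permutation of `[n]`. -/
def liftPerm {n : ℕ} (p : Equiv.Perm (Fin n)) : Hyperoctahedral n :=
  ⟨p.prodCongr (Equiv.refl Bool), fun _ => rfl⟩

/-- The sign change `(i, -i)`. -/
def signChange {n : ℕ} (i : Fin n) : Hyperoctahedral n :=
  ⟨Equiv.swap (i, false) (i, true), by
    rintro ⟨j, b⟩
    by_cases h : j = i
    · subst h
      cases b <;> simp [bar]
    · rw [Equiv.swap_apply_of_ne_of_ne, Equiv.swap_apply_of_ne_of_ne] <;> simp [bar, h]⟩

/-- The simple reflections `s_0 = (1, -1)` and `s_i = (i, i+1)(-i, -(i+1))`, `1 ≤ i < n`,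
of `B_n`. -/
def simpleReflection {n : ℕ} (i : Fin n) : Hyperoctahedral n :=
  if (i : ℕ) = 0 then signChange i
  else liftPerm (Equiv.swap ⟨(i : ℕ) - 1, lt_of_le_of_lt (Nat.sub_le _ _) i.isLt⟩ i)

/-- The set `S` of simple reflections of `B_n`. -/
def simpleReflections (n : ℕ) : Set (Hyperoctahedral n) :=
  Set.range (simpleReflection (n := n))

/-- A Coxeter element of `B_n`: the product, in some order, of all the simple reflections, each
taken once. -/
def IsCoxeterElement {n : ℕ} (c : Hyperoctahedral n) : Prop :=
  ∃ σ : Equiv.Perm (Fin n), c = (List.ofFn fun i => simpleReflection (σ i)).prod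

end TypeB

end PopTsack

set_option linter.unusedSectionVars false

/-! The Coxeter element `c` acts on the signed points as one cycle of length N = 2n. They can
therefore be identified with `ZMod N` so that `c` is the rotation `rot` and `bar` is the half turn x
↦ x + n (`IsCoxeterElement.exists_equiv`). Absolute length is the dimension of the moved space, and
this turns NC(B_n, c) into the half-turn-invariant noncrossing equivalence relations ordered by
refinement, r being encoded by its successor permutation `nxt r`. Under this dictionary π_T(w) is
`nxt (ncOrbits w)`, given by the noncrossing closure of the cycle partition of w (`toCycle_ncProj`).

The displacements `cd x (w x)` sum to N times an integer `winding w`, which is at most N - 1 and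
vanishes only at the identity. One step of the operator lowers it by `winding (nxt (ncOrbits w))`,
which is positive unless w = 1 (`winding_popZ`). Hence N - 1 steps always suffice, and needing more
than N - 3 forces winding at least N - 2. The map w ↦ (rot * w)⁻¹ complements the winding to N - 1,
and a permutation of winding at most one is the identity or the cycle through its moved points in
cyclic order. So a w that needs more than N - 3 steps is `slow A` with A invariant under the half
turn.

There are 2^n such sets A. If A is one of the n antipodal pairs, `slow A` preserves two
complementary half circles, its first step costs at least two, and N - 3 steps suffice
(`popZ_iterate_slow_pair`). Otherwise all gaps of A are shorter than n. The first n - 1 steps then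
divide by `rot`, after which all displacements are at most n; from there on every closure has at
most one nontrivial class. Every step costs at most one, so N - 3 steps are not enough
(`popZ_iterate_slow_ne_one`). -/

namespace PopTsack

/-! ### Cyclic distance on `ZMod N` -/

section Cyclic

variable {N : ℕ} [NeZero N]

/-- The number of unit steps from `x` to `y` on the cycle `ZMod N`. -/
def cd (x y : ZMod N) : ℕ := (y - x).val

/-- The least positive number of unit steps from `x` to `y` on the cycle `ZMod N`. -/
def cdp (x y : ZMod N) : ℕ := if cd x y = 0 then N else cd x y

theorem cd_lt (x y : ZMod N) : cd x y < N := ZMod.val_lt _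

@[simp] theorem cd_self (x : ZMod N) : cd x x = 0 := by simp [cd]

theorem cd_eq_zero {x y : ZMod N} : cd x y = 0 ↔ x = y := by
  rw [cd, ZMod.val_eq_zero, sub_eq_zero, eq_comm]

theorem eq_add_cd (x y : ZMod N) : y = x + (cd x y : ZMod N) := by
  simp [cd]

theorem cd_add_natCast (x : ZMod N) {k : ℕ} (hk : k < N) : cd x (x + (k : ZMod N)) = k := by
  simp [cd, ZMod.val_natCast, Nat.mod_eq_of_lt hk]

@[simp] theorem cd_add_right (x y a : ZMod N) : cd (x + a) (y + a) = cd x y := by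
  simp [cd]

theorem cd_add_cd (x y z : ZMod N) :
    cd x z = if cd x y + cd y z < N then cd x y + cd y z else cd x y + cd y z - N := by
  have h : z - x = (y - x) + (z - y) := by ring
  unfold cd
  rw [h]
  split_ifs with hlt
  · exact ZMod.val_add_of_lt hlt
  · exact ZMod.val_add_of_le (not_lt.mp hlt)

/-- Measuring everything from one base point turns cyclic order into linear arithmetic with a case
split. Most arguments about arcs below are this rewriting followed by `omega`. -/
theorem cd_base (o x y : ZMod N) :
    cd x y = if cd o x ≤ cd o y then cd o y - cd o x else cd o y + N - cd o x := by
  have h := cd_add_cd o x y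
  have h1 := cd_lt o x
  have h2 := cd_lt x y
  have h3 := cd_lt o y
  split_ifs at h ⊢ <;> omega

theorem cd_right_inj (o : ZMod N) {x y : ZMod N} : cd o x = cd o y ↔ x = y := by
  constructor
  · intro h
    rw [eq_add_cd o x, h, ← eq_add_cd]
  · rintro rfl
    rfl

theorem cdp_right_inj (o : ZMod N) {x y : ZMod N} : cdp o x = cdp o y ↔ x = y := by
  constructor
  · intro h
    have h1 := cd_lt o x
    have h2 := cd_lt o y
    apply (cd_right_inj o).1
    unfold cdp at h
    split_ifs at h <;> omega
  · rintro rfl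
    rfl

/-! ### The successor permutation of an equivalence relation -/

theorem exists_next (r : Setoid (ZMod N)) (x : ZMod N) :
    ∃ y, r x y ∧ ∀ z, r x z → cdp x y ≤ cdp x z := by
  obtain ⟨y, hy, hmin⟩ := Set.exists_min_image {y | r x y} (cdp x) (Set.toFinite _)
    ⟨x, r.refl' x⟩
  exact ⟨y, hy, hmin⟩

/-- The next element after `x` in the class of `x`. -/
noncomputable def next (r : Setoid (ZMod N)) (x : ZMod N) : ZMod N := (exists_next r x).choose

theorem rel_next (r : Setoid (ZMod N)) (x : ZMod N) : r x (next r x) :=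
  (exists_next r x).choose_spec.1

theorem cdp_next_le (r : Setoid (ZMod N)) {x z : ZMod N} (h : r x z) :
    cdp x (next r x) ≤ cdp x z :=
  (exists_next r x).choose_spec.2 z h

theorem next_eq {r : Setoid (ZMod N)} {x y : ZMod N} (h : r x y)
    (hmin : ∀ z, r x z → cdp x y ≤ cdp x z) : next r x = y :=
  (cdp_right_inj x).1 (le_antisymm (cdp_next_le r h) (hmin _ (rel_next r x)))

theorem next_eq_self_iff {r : Setoid (ZMod N)} {x : ZMod N} :
    next r x = x ↔ ∀ y, r x y → y = x := by
  constructor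
  · intro h y hy
    by_contra hne
    have h1 := cdp_next_le r hy
    have h2 := cd_lt x y
    have h3 : cd x y ≠ 0 := fun h0 => hne (cd_eq_zero.1 h0).symm
    rw [h] at h1
    simp only [cdp, cd_self, if_true, h3, if_false] at h1
    omega
  · intro h
    exact h _ (rel_next r x)

/-- There is no element of the class of `x` strictly between `x` and its successor. -/
theorem le_cd_of_rel {r : Setoid (ZMod N)} {x z : ZMod N} (h : r x z) (hz : z ≠ x) :
    cd x (next r x) ≤ cd x z ∧ 0 < cd x (next r x) := by
  have h1 := cdp_next_le r h
  have h3 : cd x z ≠ 0 := fun h0 => hz (cd_eq_zero.1 h0).symm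
  have h4 : cd x (next r x) ≠ 0 := fun h0 =>
    hz (next_eq_self_iff.1 (cd_eq_zero.1 h0).symm z h)
  simp only [cdp, h3, h4, if_false] at h1
  omega

/-- A common successor of distinct x and y would lie both on the arc (x, y] and on the disjoint arc
(y, x]. -/
theorem next_injective (r : Setoid (ZMod N)) : Function.Injective (next r) := by
  intro x y hxy
  by_contra hne
  have hr : r x y := r.trans' (rel_next r x) (hxy ▸ r.symm' (rel_next r y))
  have h1 := le_cd_of_rel hr (Ne.symm hne)
  have h2 := le_cd_of_rel (r.symm' hr) hne
  rw [← hxy] at h2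
  have h3 := cd_base x y (next r x)
  have h4 := cd_base x y x
  have h5 := cd_lt x y
  have h6 := cd_lt x (next r x)
  simp only [cd_self] at h4
  split_ifs at h3 h4 <;> omega

/-- The permutation sending every point to the next element of its class. -/
noncomputable def nxt (r : Setoid (ZMod N)) : Equiv.Perm (ZMod N) :=
  Equiv.ofBijective (next r) (Finite.injective_iff_bijective.1 (next_injective r))

@[simp] theorem nxt_apply (r : Setoid (ZMod N)) (x : ZMod N) : nxt r x = next r x := rfl

theorem sameCycle_nxt {r : Setoid (ZMod N)} {x y : ZMod N} :
    (nxt r).SameCycle x y ↔ r x y := by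
  constructor
  · intro h
    have : ∀ k : ℕ, r x (((nxt r) ^ k) x) := by
      intro k
      induction k with
      | zero => exact r.refl' x
      | succ k ih =>
        rw [pow_succ', Equiv.Perm.mul_apply]
        exact r.trans' ih (rel_next r _)
    obtain ⟨k, -, -, hk⟩ := h.exists_pow_eq''
    exact hk ▸ this k
  · intro h
    -- The successor of x never passes y, so the distance to y strictly drops.
    induction hk : cd x y using Nat.strong_induction_on generalizing x with
    | _ k ih =>
      by_cases hxy : y = x
      · rw [hxy]
      · have h1 := le_cd_of_rel h hxy
        have h2 : cd (next r x) y < k := by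
          have := cd_base x (next r x) y
          split_ifs at this <;> omega
        have h3 := ih _ h2 (r.trans' (r.symm' (rel_next r x)) h) rfl
        rw [← nxt_apply] at h3
        exact (Equiv.Perm.sameCycle_apply_left).1 h3

/-! ### Noncrossing equivalence relations -/

/-- An equivalence relation on the cycle `ZMod N` is noncrossing. -/
def NC (r : Setoid (ZMod N)) : Prop :=
  ∀ a b c d, 0 < cd a b → cd a b < cd a c → cd a c < cd a d → r a c → r b d → r a b

theorem NC.inf {r s : Setoid (ZMod N)} (hr : NC r) (hs : NC s) : NC (r ⊓ s) :=
  fun a b c d h1 h2 h3 hac hbd =>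
    ⟨hr a b c d h1 h2 h3 hac.1 hbd.1, hs a b c d h1 h2 h3 hac.2 hbd.2⟩

/-- Two classes: the half-open arc `(i, j]` and its complement. -/
def cut (i j : ZMod N) : Setoid (ZMod N) where
  r x y := (0 < cd i x ∧ cd i x ≤ cd i j) ↔ (0 < cd i y ∧ cd i y ≤ cd i j)
  iseqv := ⟨fun _ => Iff.rfl, fun h => h.symm, fun h1 h2 => h1.trans h2⟩

theorem cut_iff {i j x y : ZMod N} :
    cut i j x y ↔ ((0 < cd i x ∧ cd i x ≤ cd i j) ↔ (0 < cd i y ∧ cd i y ≤ cd i j)) := Iff.rfl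

theorem NC_cut (i j : ZMod N) : NC (cut i j) := by
  intro a b c d h1 h2 h3 hac hbd
  rw [cut_iff] at *
  rw [cd_base i a b] at h1 h2
  rw [cd_base i a c] at h2 h3
  rw [cd_base i a d] at h3
  have := cd_lt i a
  have := cd_lt i b
  have := cd_lt i c
  have := cd_lt i d
  split_ifs at * <;> omega

/-- Swapping two points of one cycle splits it along the chord from i to j. Any other class lies on
one side of the chord, since otherwise it would cross the class of i; so the cut changes only that
class. -/
theorem nxt_mul_swap {r : Setoid (ZMod N)} (hr : NC r) {i j : ZMod N} (hij : r i j)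
    (hne : i ≠ j) : nxt r * Equiv.swap i j = nxt (r ⊓ cut i j) := by
  have hij0 : 0 < cd i j := Nat.pos_of_ne_zero fun h => hne (cd_eq_zero.1 h)
  have hjl := cd_lt i j
  refine Equiv.ext fun x => ?_
  rw [Equiv.Perm.mul_apply, nxt_apply, nxt_apply]
  by_cases hxi : x = i
  · subst hxi
    rw [Equiv.swap_apply_left]
    symm
    have hy := le_cd_of_rel (r.symm' hij) hne
    set y := next r j with hydef
    have hjy : r j y := rel_next r j
    rw [cd_base x j y, cd_base x j x, cd_self] at hy
    have hyl := cd_lt x y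
    refine next_eq ⟨r.trans' hij hjy, ?_⟩ ?_
    · rw [cut_iff, cd_self]
      split_ifs at hy <;> omega
    · rintro z ⟨hz, hc⟩
      rw [cut_iff, cd_self] at hc
      have h1 := cdp_next_le r (r.trans' (r.symm' hij) hz)
      rw [← hydef] at h1
      have hzl := cd_lt x z
      unfold cdp at h1 ⊢
      rw [cd_base x j y, cd_base x j z] at h1
      split_ifs at * <;> omega
  by_cases hxj : x = j
  · subst hxj
    rw [Equiv.swap_apply_right]
    symm
    have hy := le_cd_of_rel hij (Ne.symm hne)
    set y := next r i with hydef
    have hiy : r i y := rel_next r i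
    have hyl := cd_lt i y
    refine next_eq ⟨r.trans' (r.symm' hij) hiy, ?_⟩ ?_
    · rw [cut_iff]
      omega
    · rintro z ⟨hz, hc⟩
      rw [cut_iff] at hc
      have h1 := cdp_next_le r (r.trans' hij hz)
      rw [← hydef] at h1
      have hzl := cd_lt i z
      unfold cdp at h1 ⊢
      rw [cd_base i x y, cd_base i x z]
      split_ifs at * <;> omega
  rw [Equiv.swap_apply_of_ne_of_ne hxi hxj]
  symm
  refine next_eq ⟨rel_next r x, ?_⟩ fun z hz => cdp_next_le r hz.1
  have hxi0 : 0 < cd i x := Nat.pos_of_ne_zero fun h => hxi (cd_eq_zero.1 h).symm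
  have hxj0 : cd i x ≠ cd i j := fun h => hxj ((cd_right_inj i).1 h)
  have hxl := cd_lt i x
  set y := next r x with hydef
  have hxy : r x y := rel_next r x
  have hyl := cd_lt i y
  rw [cut_iff]
  by_cases hix : r i x
  · have h1 := le_cd_of_rel (r.symm' hix) (Ne.symm hxi)
    have h2 := le_cd_of_rel (r.trans' (r.symm' hix) hij) (Ne.symm hxj)
    rw [← hydef] at h1 h2
    rw [cd_base i x y, cd_base i x i, cd_self] at h1
    rw [cd_base i x y, cd_base i x j] at h2
    split_ifs at * <;> omega
  · have hyj0 : cd i y ≠ cd i j := fun h =>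
      hix (r.trans' hij (r.symm' ((cd_right_inj i).1 h ▸ hxy)))
    have hyi0 : cd i y ≠ 0 := fun h => hix (r.symm' ((cd_eq_zero.1 h) ▸ hxy))
    have h1 := hr i x j y hxi0
    have h2 : 0 < cd i y → cd i y < cd i j → cd i j < cd i x → False := fun a b c =>
      hix (r.trans' (hr i y j x a b c hij (r.symm' hxy)) (r.symm' hxy))
    have h3 : cd i x < cd i j → cd i j < cd i y → False := fun a b => hix (h1 a b hij hxy)
    constructor
    · rintro ⟨_, _⟩
      refine ⟨by omega, ?_⟩
      by_contra hcon
      exact h3 (by omega) (by omega)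
    · rintro ⟨_, _⟩
      refine ⟨by omega, ?_⟩
      by_contra hcon
      exact h2 (by omega) (by omega) (by omega)

/-- The noncrossing closure of an equivalence relation. -/
def ncClosure (r : Setoid (ZMod N)) : Setoid (ZMod N) := sInf {s | NC s ∧ r ≤ s}

theorem NC_ncClosure (r : Setoid (ZMod N)) : NC (ncClosure r) :=
  fun a b c d h1 h2 h3 hac hbd s hs => hs.1 a b c d h1 h2 h3 (hac s hs) (hbd s hs)

theorem le_ncClosure (r : Setoid (ZMod N)) : r ≤ ncClosure r :=
  fun _ _ h _ hs => hs.2 h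

theorem ncClosure_le {r s : Setoid (ZMod N)} (hs : NC s) (h : r ≤ s) : ncClosure r ≤ s :=
  fun _ _ hxy => hxy s ⟨hs, h⟩

end Cyclic

section Winding

variable {N : ℕ} [NeZero N]

/-! ### Winding numbers of permutations of the cycle -/

/-- The sum of the displacements of a permutation of the cycle. -/
def displacement (v : Equiv.Perm (ZMod N)) : ℕ := ∑ x, cd x (v x)

/-- The number of arcs `[j, v j)` that contain `z`. -/
def cover (v : Equiv.Perm (ZMod N)) (z : ZMod N) : ℕ :=
  (Finset.univ.filter fun j => cd j z < cd j (v j)).card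

/-- The winding number of a permutation of the cycle. -/
def winding (v : Equiv.Perm (ZMod N)) : ℕ := cover v 0

theorem card_cd_lt (j : ZMod N) {k : ℕ} (hk : k ≤ N) :
    (Finset.univ.filter fun z => cd j z < k).card = k := by
  have : (Finset.univ.filter fun z => cd j z < k) =
      (Finset.range k).image fun i : ℕ => j + (i : ZMod N) := by
    ext z
    simp only [Finset.mem_filter, Finset.mem_univ, true_and, Finset.mem_image, Finset.mem_range]
    constructor
    · intro h
      exact ⟨cd j z, h, (eq_add_cd j z).symm⟩
    · rintro ⟨i, hi, rfl⟩
      rwa [cd_add_natCast j (by omega)]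
  rw [this, Finset.card_image_of_injOn, Finset.card_range]
  intro a ha b hb hab
  simp only [Finset.coe_range, Set.mem_Iio] at ha hb
  have h1 := cd_add_natCast j (show a < N by omega)
  have h2 := cd_add_natCast j (show b < N by omega)
  simp only at hab
  rw [hab] at h1
  omega

/-- Double counting of the pairs (x, z) with z on the arc [x, v x). -/
theorem displacement_eq_sum_cover (v : Equiv.Perm (ZMod N)) :
    displacement v = ∑ z, cover v z := by
  have h : ∀ x, cd x (v x) = ∑ z, if cd x z < cd x (v x) then 1 else 0 := by
    intro x
    rw [← Finset.card_filter, card_cd_lt x (cd_lt _ _).le]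
  unfold displacement cover
  simp_rw [Finset.card_filter]
  rw [Finset.sum_comm]
  exact Finset.sum_congr rfl fun x _ => h x

theorem cd_add_one (j z : ZMod N) :
    cd j (z + 1) = if cd j z + 1 = N then 0 else cd j z + 1 := by
  have h1 := cd_lt j z
  split_ifs with h
  · rw [cd_eq_zero, eq_add_cd j z, add_assoc]
    have : ((cd j z : ZMod N) + 1) = ((cd j z + 1 : ℕ) : ZMod N) := by push_cast; ring
    rw [this, h]
    simp
  · have : z + 1 = j + ((cd j z + 1 : ℕ) : ZMod N) := by
      push_cast
      rw [← add_assoc, ← eq_add_cd]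
    rw [this, cd_add_natCast _ (by omega)]

/-- Passing from z to z + 1 loses the one arc that ends at z + 1 and gains the one that starts
there. If z + 1 is fixed, neither exists. -/
theorem cover_add_one (v : Equiv.Perm (ZMod N)) (z : ZMod N) :
    cover v (z + 1) = cover v z := by
  classical
  have key : ∀ j, j ≠ z + 1 →
      (cd j (z + 1) < cd j (v j) ↔ cd j z < cd j (v j) ∧ v j ≠ z + 1) := by
    intro j hj
    have h1 := cd_add_one j z
    have h2 : cd j (z + 1) ≠ 0 := fun h => hj (cd_eq_zero.1 h)
    have h3 : v j ≠ z + 1 ↔ cd j (v j) ≠ cd j (z + 1) := (cd_right_inj j).not.symm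
    rw [h3]
    split_ifs at h1 <;> omega
  have hnot : ¬ cd (z + 1) z < cd (z + 1) (v (z + 1)) := by
    have h1 := cd_add_one (z + 1) z
    have h2 := cd_lt (z + 1) (v (z + 1))
    rw [cd_self] at h1
    split_ifs at h1 <;> omega
  unfold cover
  by_cases hfix : v (z + 1) = z + 1
  · congr 1
    ext j
    simp only [Finset.mem_filter, Finset.mem_univ, true_and]
    by_cases hj : j = z + 1
    · subst hj
      rw [hfix] at hnot ⊢
      simp
    · rw [key j hj]
      exact ⟨fun h => h.1, fun h => ⟨h, fun h' => hj (v.injective (h'.trans hfix.symm))⟩⟩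
  · have hq : cd (v.symm (z + 1)) z < cd (v.symm (z + 1)) (v (v.symm (z + 1))) := by
      rw [Equiv.apply_symm_apply]
      have h1 := cd_add_one (v.symm (z + 1)) z
      have h2 : cd (v.symm (z + 1)) (z + 1) ≠ 0 := fun h => by
        rw [cd_eq_zero, Equiv.symm_apply_eq] at h
        exact hfix h.symm
      split_ifs at h1 <;> omega
    have hset : (Finset.univ.filter fun j => cd j (z + 1) < cd j (v j)) =
        insert (z + 1) ((Finset.univ.filter fun j => cd j z < cd j (v j)).erase
          (v.symm (z + 1))) := by
      ext j
      simp only [Finset.mem_filter, Finset.mem_univ, true_and, Finset.mem_insert,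
        Finset.mem_erase]
      by_cases hj : j = z + 1
      · subst hj
        simp only [cd_self, true_or, iff_true]
        exact Nat.pos_of_ne_zero fun h => hfix (cd_eq_zero.1 h).symm
      · rw [key j hj]
        simp only [hj, false_or, ne_eq, Equiv.eq_symm_apply]
        tauto
    rw [hset, Finset.card_insert_of_notMem, Finset.card_erase_of_mem]
    · have : 0 < (Finset.univ.filter fun j => cd j z < cd j (v j)).card :=
        Finset.card_pos.2 ⟨v.symm (z + 1), by simpa using hq⟩
      omega
    · simpa using hq
    · simp only [Finset.mem_erase, Finset.mem_filter, Finset.mem_univ, true_and, not_and]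
      exact fun _ => hnot

theorem cover_eq_winding (v : Equiv.Perm (ZMod N)) (z : ZMod N) : cover v z = winding v := by
  have h : ∀ k : ℕ, cover v (k : ZMod N) = winding v := by
    intro k
    induction k with
    | zero => simp [winding]
    | succ k ih => rw [Nat.cast_succ, cover_add_one, ih]
  have := h z.val
  rwa [ZMod.natCast_zmod_val] at this

theorem displacement_eq (v : Equiv.Perm (ZMod N)) : displacement v = N * winding v := by
  rw [displacement_eq_sum_cover, Finset.sum_congr rfl fun z _ => cover_eq_winding v z]
  simp [ZMod.card]

theorem winding_eq_zero {v : Equiv.Perm (ZMod N)} : winding v = 0 ↔ v = 1 := by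
  have hN : N ≠ 0 := NeZero.ne N
  have h := displacement_eq v
  constructor
  · intro h0
    rw [h0, mul_zero, displacement, Finset.sum_eq_zero_iff] at h
    ext x
    rw [← cd_eq_zero.1 (h x (Finset.mem_univ x))]
    rfl
  · rintro rfl
    have : displacement (1 : Equiv.Perm (ZMod N)) = 0 := by simp [displacement]
    rw [this] at h
    simpa [hN] using h.symm

theorem winding_eq_of_displacement_add {u v w : Equiv.Perm (ZMod N)}
    (h : displacement u + displacement v = displacement w) :
    winding u + winding v = winding w := by
  rw [displacement_eq, displacement_eq, displacement_eq, ← mul_add] at h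
  exact Nat.eq_of_mul_eq_mul_left (NeZero.pos N) h

/-- Two distinct arcs that contain a common point force the winding number to be at least two. -/
theorem two_le_winding {v : Equiv.Perm (ZMod N)} {z i j : ZMod N} (hij : i ≠ j)
    (hi : cd i z < cd i (v i)) (hj : cd j z < cd j (v j)) : 2 ≤ winding v := by
  rw [← cover_eq_winding v z]
  exact Finset.one_lt_card.2 ⟨i, by simpa using hi, j, by simpa using hj, hij⟩

theorem exists_of_two_le_winding {v : Equiv.Perm (ZMod N)} (h : 2 ≤ winding v) (z : ZMod N) :
    ∃ i j, i ≠ j ∧ cd i z < cd i (v i) ∧ cd j z < cd j (v j) := by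
  rw [← cover_eq_winding v z] at h
  obtain ⟨i, hi, j, hj, hij⟩ := Finset.one_lt_card.1 h
  exact ⟨i, j, hij, by simpa using hi, by simpa using hj⟩

/-! ### Equivalence relations with at most one nontrivial class -/

/-- The equivalence relation whose only class with more than one element is `A`. -/
def block (A : Set (ZMod N)) : Setoid (ZMod N) where
  r x y := x = y ∨ (x ∈ A ∧ y ∈ A)
  iseqv :=
    ⟨fun _ => Or.inl rfl, by
      rintro x y (h | h)
      · exact Or.inl h.symm
      · exact Or.inr ⟨h.2, h.1⟩, by
      rintro x y z (rfl | h) (rfl | h')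
      · exact Or.inl rfl
      · exact Or.inr h'
      · exact Or.inr h
      · exact Or.inr ⟨h.1, h'.2⟩⟩

theorem block_iff {A : Set (ZMod N)} {x y : ZMod N} :
    block A x y ↔ x = y ∨ (x ∈ A ∧ y ∈ A) := Iff.rfl

theorem NC_block (A : Set (ZMod N)) : NC (block A) := by
  intro a b c d h1 h2 h3 hac hbd
  rw [block_iff] at *
  rcases hac with rfl | hac
  · rw [cd_self] at h2
    omega
  rcases hbd with rfl | hbd
  · omega
  · exact Or.inr ⟨hac.1, hbd.1⟩

/-- The arcs of moved points do not overlap, so none starts strictly inside the arc from x to v x.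
As v x is itself moved, it is the next moved point after x. -/
theorem eq_nxt_block_of_winding_le_one {v : Equiv.Perm (ZMod N)} (h : winding v ≤ 1) :
    v = nxt (block {x | v x ≠ x}) := by
  refine Equiv.ext fun x => ?_
  rw [nxt_apply]
  symm
  by_cases hx : v x = x
  · rw [hx, next_eq_self_iff]
    rintro y (rfl | hy)
    · rfl
    · exact absurd hx hy.1
  · refine next_eq (Or.inr ⟨hx, fun h' => hx (v.injective h')⟩) ?_
    intro z hz
    by_contra hlt
    have hzm : v z ≠ z := by
      rcases hz with rfl | hz
      · exact hx
      · exact hz.2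
    have h0 : cd x (v x) ≠ 0 := fun h0 => hx (cd_eq_zero.1 h0).symm
    have h1 := cd_lt x (v x)
    have h2 : cd z (v z) ≠ 0 := fun h0 => hzm (cd_eq_zero.1 h0).symm
    have hlt' : cd x z < cd x (v x) ∧ cd x z ≠ 0 := by
      unfold cdp at hlt
      split_ifs at hlt <;> omega
    have hne : x ≠ z := fun h' => hlt'.2 (cd_eq_zero.2 h')
    have := two_le_winding (v := v) (z := z) hne hlt'.1 (by rw [cd_self]; omega)
    omega

/-- The hypothesis excludes singletons, for which `block A` is trivial and A cannot be recovered. -/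
theorem setOf_nxt_block_ne {A : Set (ZMod N)} (hA : ∀ a ∈ A, ∃ b ∈ A, b ≠ a) :
    {x | nxt (block A) x ≠ x} = A := by
  ext x
  simp only [nxt_apply, ne_eq, Set.mem_ofPred_eq, next_eq_self_iff]
  constructor
  · intro h
    by_contra hx
    refine h fun y hy => ?_
    rcases hy with rfl | hy
    · rfl
    · exact absurd hy.1 hx
  · intro hx h
    obtain ⟨b, hb, hbx⟩ := hA x hx
    exact hbx (h b (Or.inr ⟨hx, hb⟩))

/-- Two points with nontrivial classes whose arcs overlap lie in different classes. -/
theorem not_rel_of_overlap {r : Setoid (ZMod N)} {i j z : ZMod N} (hij : i ≠ j)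
    (hi : cd i z < cd i (nxt r i)) (hj : cd j z < cd j (nxt r j)) : ¬ r i j := by
  intro hr
  have h1 := le_cd_of_rel hr hij.symm
  have h2 := le_cd_of_rel (r.symm' hr) hij
  rw [nxt_apply] at hi hj
  have h3 := cd_base i j z
  have h4 := cd_base i j i
  have h5 := cd_lt i j
  have h6 := cd_lt i z
  rw [cd_self] at h4
  split_ifs at h3 h4 <;> omega

theorem winding_nxt_block_le_one (A : Set (ZMod N)) : winding (nxt (block A)) ≤ 1 := by
  by_contra h
  obtain ⟨i, j, hij, hi, hj⟩ := exists_of_two_le_winding (not_le.1 h) 0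
  refine not_rel_of_overlap hij hi hj (Or.inr ⟨?_, ?_⟩)
  · by_contra hA
    have : next (block A) i = i := next_eq_self_iff.2 fun y hy => by
      rcases hy with rfl | hy
      · rfl
      · exact absurd hy.1 hA
    rw [nxt_apply, this, cd_self] at hi
    omega
  · by_contra hA
    have : next (block A) j = j := next_eq_self_iff.2 fun y hy => by
      rcases hy with rfl | hy
      · rfl
      · exact absurd hy.1 hA
    rw [nxt_apply, this, cd_self] at hj
    omega

/-! ### The operator on permutations of the cycle -/

/-- The noncrossing closure of the cycle partition of a permutation. -/
def ncOrbits (w : Equiv.Perm (ZMod N)) : Setoid (ZMod N) :=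
  ncClosure (Equiv.Perm.SameCycle.setoid w)

theorem NC_ncOrbits (w : Equiv.Perm (ZMod N)) : NC (ncOrbits w) := NC_ncClosure _

theorem ncOrbits_apply (w : Equiv.Perm (ZMod N)) (x : ZMod N) : ncOrbits w x (w x) :=
  le_ncClosure (Equiv.Perm.SameCycle.setoid w) (Equiv.Perm.SameCycle.refl w x).apply_right

theorem ncOrbits_le {w : Equiv.Perm (ZMod N)} {s : Setoid (ZMod N)} (hs : NC s)
    (h : ∀ x, s x (w x)) : ncOrbits w ≤ s := by
  refine ncClosure_le hs fun x y hxy => ?_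
  obtain ⟨k, -, -, rfl⟩ := Equiv.Perm.SameCycle.exists_pow_eq'' (f := w) hxy
  clear hxy
  induction k with
  | zero => exact s.refl' x
  | succ k ih =>
    rw [pow_succ', Equiv.Perm.mul_apply]
    exact s.trans' ih (h _)

/-- The closure never absorbs a fixed point, because the relation with the single class of all moved
points is noncrossing and already contains the cycles. -/
theorem next_ncOrbits_eq_self {w : Equiv.Perm (ZMod N)} {x : ZMod N} :
    next (ncOrbits w) x = x ↔ w x = x := by
  rw [next_eq_self_iff]
  constructor
  · intro h
    exact h _ (ncOrbits_apply w x)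
  · intro h y hy
    have hle : ncOrbits w ≤ block {x | w x ≠ x} := ncOrbits_le (NC_block _) fun z => by
      by_cases hz : w z = z
      · exact Or.inl hz.symm
      · exact Or.inr ⟨hz, fun h' => hz (w.injective h')⟩
    rcases hle hy with h' | h'
    · exact h'.symm
    · exact absurd h h'.1

/-- The pop-tsack torsing operator on permutations of the cycle. -/
noncomputable def popZ (w : Equiv.Perm (ZMod N)) : Equiv.Perm (ZMod N) :=
  w * (nxt (ncOrbits w))⁻¹

theorem popZ_next (w : Equiv.Perm (ZMod N)) (x : ZMod N) :
    popZ w (next (ncOrbits w) x) = w x := by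
  simp [popZ, ← nxt_apply]

/-- The point w x is in the class of x, so the successor of x lies on the arc from x to w x and
divides it in two. The second piece is the arc of `popZ w` at the successor. -/
theorem cd_next_add (w : Equiv.Perm (ZMod N)) (x : ZMod N) :
    cd (next (ncOrbits w) x) (popZ w (next (ncOrbits w) x)) + cd x (next (ncOrbits w) x) =
      cd x (w x) := by
  rw [popZ_next]
  by_cases hx : w x = x
  · rw [next_ncOrbits_eq_self.2 hx, hx]
    simp
  · have h1 := (le_cd_of_rel (ncOrbits_apply w x) hx).1
    rw [cd_base x (next (ncOrbits w) x) (w x), if_pos h1]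
    omega

theorem winding_popZ (w : Equiv.Perm (ZMod N)) :
    winding (popZ w) + winding (nxt (ncOrbits w)) = winding w := by
  apply winding_eq_of_displacement_add
  unfold displacement
  rw [← Equiv.sum_comp (nxt (ncOrbits w)) fun x => cd x (popZ w x), ← Finset.sum_add_distrib]
  exact Finset.sum_congr rfl fun x _ => cd_next_add w x

theorem winding_nxt_ncOrbits_pos {w : Equiv.Perm (ZMod N)} (hw : w ≠ 1) :
    0 < winding (nxt (ncOrbits w)) := by
  rw [Nat.pos_iff_ne_zero, ne_eq, winding_eq_zero]
  intro h
  refine hw (Equiv.ext fun x => ?_)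
  have : next (ncOrbits w) x = x := by rw [← nxt_apply, h]; rfl
  exact next_ncOrbits_eq_self.1 this

theorem popZ_one : popZ (1 : Equiv.Perm (ZMod N)) = 1 := by
  have h := winding_popZ (1 : Equiv.Perm (ZMod N))
  rw [winding_eq_zero.2 (rfl : (1 : Equiv.Perm (ZMod N)) = 1)] at h
  exact winding_eq_zero.1 (by omega)

theorem popZ_iterate_one (m : ℕ) : popZ^[m] (1 : Equiv.Perm (ZMod N)) = 1 :=
  Function.iterate_fixed popZ_one m

theorem winding_popZ_iterate (w : Equiv.Perm (ZMod N)) (m : ℕ) :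
    winding (popZ^[m] w) ≤ winding w - m := by
  induction m generalizing w with
  | zero => simp
  | succ m ih =>
    rw [Function.iterate_succ_apply]
    by_cases hw : w = 1
    · rw [hw, popZ_one, popZ_iterate_one, winding_eq_zero.2 rfl]
      omega
    · have h1 := ih (popZ w)
      have h2 := winding_popZ w
      have h3 := winding_nxt_ncOrbits_pos hw
      omega

/-- The rotation of the cycle by one step. -/
def rot : Equiv.Perm (ZMod N) := Equiv.addRight 1

@[simp] theorem rot_apply (x : ZMod N) : (rot : Equiv.Perm (ZMod N)) x = x + 1 := rfl

theorem cd_add_one_left (x y : ZMod N) : cd x y + cd (y + 1) x + 1 = N := by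
  have h1 := cd_base x (y + 1) x
  have h2 := cd_add_one x y
  have h3 := cd_lt x y
  rw [cd_self] at h1
  split_ifs at h1 h2 <;> omega

/-- The arc from x to w x, one more unit step, and the arc of (rot * w)⁻¹ back to x make exactly one
full turn; sum over x. In particular every winding number is at most N - 1. -/
theorem winding_add_winding_inv (w : Equiv.Perm (ZMod N)) :
    winding w + winding (rot * w)⁻¹ + 1 = N := by
  have h : displacement w + displacement (rot * w)⁻¹ + N = N * N := by
    unfold displacement
    rw [← Equiv.sum_comp (rot * w) fun x => cd x (((rot * w)⁻¹ : Equiv.Perm (ZMod N)) x)]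
    have hN : (∑ _x : ZMod N, 1) = N := by simp [ZMod.card]
    have hNN : (∑ _x : ZMod N, N) = N * N := by simp [ZMod.card]
    refine (congrArg₂ (· + ·) rfl hN.symm).trans (Eq.trans ?_ hNN)
    rw [← Finset.sum_add_distrib, ← Finset.sum_add_distrib]
    refine Finset.sum_congr rfl fun x _ => ?_
    have h1 : ∀ u : Equiv.Perm (ZMod N), u⁻¹ (u x) = x := fun u => by simp
    rw [h1]
    exact cd_add_one_left x (w x)
  rw [displacement_eq, displacement_eq] at h
  have : N * (winding w + winding (rot * w)⁻¹ + 1) = N * N := by linarith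
  exact Nat.eq_of_mul_eq_mul_left (NeZero.pos N) this

end Winding

section Symmetric

variable {N : ℕ} [NeZero N]

/-! ### Symmetric equivalence relations on an even cycle -/

/-- Invariance of an equivalence relation under the rotation by `n`. -/
def Sym (n : ℕ) (r : Setoid (ZMod N)) : Prop :=
  ∀ x y, r x y → r (x + (n : ZMod N)) (y + (n : ZMod N))

/-- Invariance of a permutation under the rotation by `n`. -/
def SymPerm (n : ℕ) (w : Equiv.Perm (ZMod N)) : Prop :=
  ∀ x, w (x + (n : ZMod N)) = w x + (n : ZMod N)

theorem NC.comap_add {r : Setoid (ZMod N)} (hr : NC r) (m : ZMod N) :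
    NC (r.comap fun x => x + m) := by
  intro a b c d h1 h2 h3 hac hbd
  refine hr (a + m) (b + m) (c + m) (d + m) ?_ ?_ ?_ hac hbd <;> simpa

theorem SymPerm.ncOrbits {n : ℕ} {w : Equiv.Perm (ZMod N)} (hw : SymPerm n w) :
    Sym n (ncOrbits w) := by
  have : PopTsack.ncOrbits w ≤ (PopTsack.ncOrbits w).comap fun x => x + (n : ZMod N) :=
    ncOrbits_le ((NC_ncOrbits w).comap_add _) fun x => by
      change PopTsack.ncOrbits w (x + n) (w x + n)
      rw [← hw]
      exact ncOrbits_apply w _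
  exact fun x y h => this h

theorem half_add_half {n : ℕ} (hN : N = 2 * n) : (n : ZMod N) + n = 0 := by
  have : ((2 * n : ℕ) : ZMod N) = 0 := by rw [← hN]; simp
  rw [← this]; push_cast; ring

theorem Sym.nxt {n : ℕ} {r : Setoid (ZMod N)} (hr : Sym n r)
    (hN : N = 2 * n) : SymPerm n (nxt r) := by
  have hnn := half_add_half hN
  intro x
  rw [nxt_apply, nxt_apply]
  refine next_eq (hr _ _ (rel_next r x)) fun z hz => ?_
  have h1 := hr _ _ hz
  rw [add_assoc, hnn, add_zero] at h1
  have h2 := cdp_next_le r h1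
  have h3 : z = z + n + n := by rw [add_assoc, hnn, add_zero]
  unfold cdp at h2 ⊢
  rw [h3, cd_add_right, cd_add_right]
  exact h2

theorem SymPerm.mul {n : ℕ} {u v : Equiv.Perm (ZMod N)} (hu : SymPerm n u) (hv : SymPerm n v) :
    SymPerm n (u * v) := fun x => by
  rw [Equiv.Perm.mul_apply, Equiv.Perm.mul_apply, hv, hu]

theorem SymPerm.inv {n : ℕ} {u : Equiv.Perm (ZMod N)} (hu : SymPerm n u) :
    SymPerm n u⁻¹ := fun x => by
  rw [Equiv.Perm.inv_eq_iff_eq, hu]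
  simp

theorem SymPerm.rot (n : ℕ) : SymPerm n (rot : Equiv.Perm (ZMod N)) := fun x => by
  simp only [rot_apply]; ring

theorem SymPerm.popZ {n : ℕ} {w : Equiv.Perm (ZMod N)} (hw : SymPerm n w) (hN : N = 2 * n) :
    SymPerm n (popZ w) :=
  hw.mul (hw.ncOrbits.nxt hN).inv

theorem cd_half {n : ℕ} (hN : N = 2 * n) (x : ZMod N) : cd x (x + (n : ZMod N)) = n := by
  have := NeZero.pos N
  exact cd_add_natCast x (by omega)

/-- A class of a symmetric noncrossing relation that is not symmetric is contained in an arc of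
length less than `n` that is a union of classes. -/
theorem exists_hull {n : ℕ} (hN : N = 2 * n) {r : Setoid (ZMod N)} (hr : NC r) (hs : Sym n r)
    {x : ZMod N} (hx : ¬ r x (x + n)) (hmv : next r x ≠ x) :
    ∃ a b, r a b ∧ 0 < cd a b ∧ cd a b < n ∧
      ∀ p q, r p q → cd a p ≤ cd a b → cd a q ≤ cd a b := by
  -- Here b is the last point of the class before the antipode z of x, so the gap from b to its
  -- successor a contains z.
  obtain ⟨b, hb, hmin⟩ := Set.exists_min_image {y | r x y} (fun y => cd y (x + n))
    (Set.toFinite _) ⟨x, r.refl' x⟩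
  simp only [Set.mem_ofPred_eq] at hb hmin
  set z : ZMod N := x + n with hz
  set a := next r b with ha
  have hba : r b a := rel_next r b
  have hab : a ≠ b := by
    intro h
    have h1 := next_eq_self_iff.1 h
    have h2 := h1 x (r.symm' hb)
    rw [← h2] at h1
    exact hmv (h1 _ (rel_next r x))
  have hab0 : cd b a ≠ 0 := fun h => hab (cd_eq_zero.1 h).symm
  have hbz0 : cd b z ≠ 0 := fun h => hx (by rw [← cd_eq_zero.1 h]; exact hb)
  have haz0 : cd b a ≠ cd b z := fun h =>
    hx (by rw [← (cd_right_inj b).1 h]; exact r.trans' hb hba)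
  have hal := cd_lt b a
  have hzl := cd_lt b z
  have hza : cd b z < cd b a := by
    have h1 := hmin a (r.trans' hb hba)
    rw [cd_base b a z] at h1
    split_ifs at h1 <;> omega
  have hxa : r x a := r.trans' hb hba
  have hzan : r z (a + n) := hs _ _ hxa
  -- The antipodal class contains z and a + n and cannot cross the chord from b to a, so a + n lies
  -- in the same gap as z. Thus b comes before a + n when starting from a, and the arc from a to b
  -- is shorter than n.
  have hann : cd b (a + n) < cd b a := by
    by_contra hcon
    have hne : cd b (a + n) ≠ cd b a := fun h => by
      rw [(cd_right_inj b).1 h] at hzan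
      exact hx (r.trans' hxa (r.symm' hzan))
    have := hr b z a (a + n) (by omega) hza (by omega) hba hzan
    exact hx (r.trans' hb this)
  have hann0 : cd b (a + n) ≠ 0 := fun h => by
    rw [← cd_eq_zero.1 h] at hzan
    exact hx (r.trans' hb (r.symm' hzan))
  have hn := cd_half hN a
  rw [cd_base b a (a + n)] at hn
  have hab' := cd_base b a b
  rw [cd_self] at hab'
  refine ⟨a, b, r.symm' hba, ?_, ?_, ?_⟩
  · split_ifs at hab' <;> omega
  · split_ifs at hab' hn <;> omega
  -- A class meeting both the arc [a, b] and the gap beyond b would cross the chord from b to a.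
  · intro p q hpq hp
    by_contra hq
    have hpl := cd_lt b p
    have hql := cd_lt b q
    have hp' := cd_base b a p
    have hq' := cd_base b a q
    have hq2 : 0 < cd b q ∧ cd b q < cd b a := by
      split_ifs at * <;> omega
    have hbq : ¬ r b q := by
      intro h
      have hqb : q ≠ b := by
        rintro rfl
        simp at hq2
      have := (le_cd_of_rel h hqb).1
      rw [← ha] at this
      omega
    have hbp : ¬ r b p := fun h => hbq (r.trans' h hpq)
    have hp0 : cd b p ≠ 0 := fun h => hbp (by rw [← cd_eq_zero.1 h])
    have hpa : cd b p ≠ cd b a := fun h => hbp (by rw [(cd_right_inj b).1 h]; exact hba)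
    refine hbq (hr b q a p hq2.1 hq2.2 ?_ hba (r.symm' hpq))
    split_ifs at * <;> omega

/-- If two nontrivial classes of a symmetric noncrossing relation are distinct, then one of them
is not symmetric. -/
theorem exists_not_symmetric {n : ℕ} (hN : N = 2 * n) {r : Setoid (ZMod N)} (hr : NC r)
    {x y : ZMod N} (hxy : ¬ r x y) : ¬ r x (x + n) ∨ ¬ r y (y + n) := by
  by_contra! hcon
  obtain ⟨h1, h2⟩ := hcon
  have hn := cd_half hN x
  have hm := cd_half hN y
  rw [cd_base x y (y + n)] at hm
  have hyl := cd_lt x y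
  have hyl' := cd_lt x (y + n)
  have hy0 : cd x y ≠ 0 := fun h => hxy (by rw [cd_eq_zero.1 h])
  have hyn : cd x y ≠ cd x (x + n) := fun h => hxy (by rw [(cd_right_inj x).1 h]; exact h1)
  have hyn' : cd x (y + n) ≠ 0 := fun h => hxy (by
    have := cd_eq_zero.1 h
    rw [← this] at h2
    exact r.symm' h2)
  -- One of y, y + n lies strictly inside the half turn from x to x + n, so the two antipodal pairs
  -- cross.
  rcases lt_or_ge (cd x y) n with hlt | hge
  · refine hxy (hr x y (x + n) (y + n) (by omega) (by omega) ?_ h1 h2)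
    split_ifs at hm <;> omega
  · have h3 : r x (y + n) := by
      refine hr x (y + n) (x + n) y (by omega) ?_ ?_ h1 (r.symm' h2)
      · split_ifs at hm <;> omega
      · omega
    exact hxy (r.trans' h3 (r.symm' h2))

/-- If all displacements of a symmetric permutation are at most `n`, then its noncrossing closure
has at most one nontrivial class. -/
theorem winding_nxt_ncOrbits_le_one {n : ℕ} (hN : N = 2 * n) {w : Equiv.Perm (ZMod N)}
    (hw : SymPerm n w) (hd : ∀ x, cd x (w x) ≤ n) : winding (nxt (ncOrbits w)) ≤ 1 := by
  by_contra h
  obtain ⟨i, j, hij, hi, hj⟩ := exists_of_two_le_winding (not_le.1 h) 0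
  have hnr := not_rel_of_overlap hij hi hj
  have hmv : ∀ k, cd k (0 : ZMod N) < cd k (nxt (ncOrbits w) k) →
      next (ncOrbits w) k ≠ k := by
    intro k hk h'
    rw [nxt_apply, h', cd_self] at hk
    omega
  -- The last point b of the hull [a, b] of such a class is moved but must stay inside the hull. Its
  -- image then precedes b by less than n, a displacement greater than n.
  have key : ∀ x, ¬ ncOrbits w x (x + n) → next (ncOrbits w) x ≠ x → False := by
    intro x hx hx'
    obtain ⟨a, b, hab, h0, hlt, hsat⟩ := exists_hull hN (NC_ncOrbits w) hw.ncOrbits hx hx'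
    have hwb : w b ≠ b := by
      intro hb
      have := next_eq_self_iff.1 (next_ncOrbits_eq_self.2 hb) a ((ncOrbits w).symm' hab)
      rw [this, cd_self] at h0
      omega
    have h1 := hsat b (w b) (ncOrbits_apply w b) le_rfl
    have h2 := hd b
    rw [cd_base a b (w b)] at h2
    have h3 : cd a (w b) ≠ cd a b := fun h => hwb ((cd_right_inj a).1 h)
    split_ifs at h2 <;> omega
  rcases exists_not_symmetric hN (NC_ncOrbits w) hnr with h' | h'
  · exact key i h' (hmv i hi)
  · exact key j h' (hmv j hj)

theorem cd_popZ_le {w : Equiv.Perm (ZMod N)} {k : ℕ} (h : ∀ x, cd x (w x) ≤ k) (x : ZMod N) :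
    cd x (popZ w x) ≤ k := by
  obtain ⟨y, rfl⟩ := (nxt (ncOrbits w)).surjective x
  have h1 := cd_next_add w y
  have h2 := h y
  rw [nxt_apply]
  omega

/-- The bound n on displacements survives each step by `cd_popZ_le`, so every step removes at most
one from the winding. -/
theorem le_winding_iterate_of_cd_le {n : ℕ} (hN : N = 2 * n) {w : Equiv.Perm (ZMod N)}
    (hw : SymPerm n w) (hd : ∀ x, cd x (w x) ≤ n) (m : ℕ) :
    winding w ≤ winding (popZ^[m] w) + m := by
  induction m generalizing w with
  | zero => simp
  | succ m ih =>
    rw [Function.iterate_succ_apply]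
    have h1 := ih (hw.popZ hN) (cd_popZ_le hd)
    have h2 := winding_popZ w
    have h3 := winding_nxt_ncOrbits_le_one hN hw hd
    omega

/-! ### Slow permutations -/

/-- The permutation `rot⁻¹ * v⁻¹` for `v` the cycle through `A`. -/
noncomputable def slow (A : Set (ZMod N)) : Equiv.Perm (ZMod N) :=
  (rot)⁻¹ * (nxt (block A))⁻¹

theorem rot_inv_apply (x : ZMod N) : (rot⁻¹ : Equiv.Perm (ZMod N)) x = x - 1 := by
  rw [Equiv.Perm.inv_eq_iff_eq, rot_apply]
  ring

theorem rot_pow_inv_apply (t : ℕ) (x : ZMod N) :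
    ((rot ^ t)⁻¹ : Equiv.Perm (ZMod N)) x = x - t := by
  induction t generalizing x with
  | zero => simp
  | succ t ih =>
    rw [pow_succ, mul_inv_rev, Equiv.Perm.mul_apply, ih, rot_inv_apply]
    push_cast
    ring

theorem slow_apply_next (A : Set (ZMod N)) (x : ZMod N) :
    slow A (next (block A) x) = x - 1 := by
  rw [slow, Equiv.Perm.mul_apply, rot_inv_apply, ← nxt_apply,
    Equiv.Perm.inv_eq_iff_eq.2 rfl]

theorem winding_slow (A : Set (ZMod N)) :
    winding (slow A) + winding (nxt (block A)) + 1 = N := by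
  have h := winding_add_winding_inv (slow A)
  have : (rot * slow A)⁻¹ = nxt (block A) := by simp [slow]
  rwa [this] at h

theorem eq_slow_of_le_winding {w : Equiv.Perm (ZMod N)} (hw : N ≤ winding w + 2) :
    w = slow {x | (rot * w : Equiv.Perm (ZMod N))⁻¹ x ≠ x} := by
  have h := winding_add_winding_inv w
  have h1 := eq_nxt_block_of_winding_le_one (v := (rot * w)⁻¹) (by omega)
  rw [slow, ← h1]
  simp

theorem rot_eq_nxt_top : (rot : Equiv.Perm (ZMod N)) = nxt (block Set.univ) := by
  refine Equiv.ext fun x => ?_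
  rw [nxt_apply, rot_apply]
  symm
  refine next_eq (Or.inr ⟨trivial, trivial⟩) fun z _ => ?_
  have h1 := cd_add_one x x
  have h2 := cd_lt x z
  rw [cd_self] at h1
  unfold cdp
  split_ifs at * <;> omega

theorem nxt_eq_rot {r : Setoid (ZMod N)} (h : ∀ x y, r x y) : nxt r = rot := by
  rw [rot_eq_nxt_top]
  congr 1
  ext x y
  exact ⟨fun _ => Or.inr ⟨trivial, trivial⟩, fun _ => h x y⟩

theorem cd_sub_natCast (x : ZMod N) {k : ℕ} (hk : k < N) (hk0 : 0 < k) :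
    cd x (x - (k : ZMod N)) = N - k := by
  have h : x - (k : ZMod N) = x + ((N - k : ℕ) : ZMod N) := by
    rw [Nat.cast_sub hk.le]
    simp [sub_eq_add_neg]
  rw [h, cd_add_natCast x (by omega)]

/-- As long as no point is fixed, the noncrossing closure of `slow A * rot ^ (-t)` is trivial when
all gaps of `A` are less than `n`. -/
theorem nxt_ncOrbits_slow_mul {n : ℕ} (hN : N = 2 * n) {A : Set (ZMod N)}
    (hA : Sym n (block A)) (hgap : ∀ x, cd x (next (block A) x) < n) {t : ℕ} (ht : t + 2 ≤ n) :
    nxt (ncOrbits (slow A * (rot ^ t)⁻¹)) = rot := by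
  set w := slow A * (rot ^ t)⁻¹ with hwdef
  have hform : ∀ y, w (next (block A) y + t) = y - 1 := by
    intro y
    rw [hwdef, Equiv.Perm.mul_apply, rot_pow_inv_apply, add_sub_cancel_right, slow_apply_next]
  have hform' : ∀ y, w (next (block A) y + t) =
      (next (block A) y + t) - ((cd y (next (block A) y) + t + 1 : ℕ) : ZMod N) := by
    intro y
    rw [hform]
    have := eq_add_cd y (next (block A) y)
    push_cast
    linear_combination -this
  -- Gap at most n - 1 and t ≤ n - 2 keep this displacement strictly between 0 and N, so w has no
  -- fixed point.
  have hcd : ∀ y, cd (next (block A) y + (t : ZMod N)) (w (next (block A) y + t)) =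
      N - (cd y (next (block A) y) + t + 1) := by
    intro y
    rw [hform']
    have := hgap y
    exact cd_sub_natCast _ (by omega) (by omega)
  have hsurj : ∀ x, ∃ y, x = next (block A) y + (t : ZMod N) := by
    intro x
    obtain ⟨y, hy⟩ := (nxt (block A)).surjective (x - t)
    exact ⟨y, by rw [← nxt_apply, hy]; ring⟩
  have hsw : SymPerm n w :=
    ((SymPerm.rot n).inv.mul (hA.nxt hN).inv).mul (by
      have : ∀ t : ℕ, SymPerm n (rot ^ t : Equiv.Perm (ZMod N)) := by
        intro t
        induction t with
        | zero => exact fun x => rfl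
        | succ t ih => rw [pow_succ]; exact ih.mul (SymPerm.rot n)
      exact (this t).inv)
  have hmv : ∀ x, next (ncOrbits w) x ≠ x := by
    intro x hx
    rw [next_ncOrbits_eq_self] at hx
    obtain ⟨y, rfl⟩ := hsurj x
    have h1 := hcd y
    rw [hx, cd_self] at h1
    have := hgap y
    omega
  have key : ∀ x, ¬ ncOrbits w x (x + n) → False := by
    intro x hx
    obtain ⟨a, b, hab, h0, hlt, hsat⟩ :=
      exists_hull hN (NC_ncOrbits w) hsw.ncOrbits hx (hmv x)
    obtain ⟨y, hy⟩ := hsurj a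
    -- Since w a stays in a hull shorter than n, the gap at y satisfies gap + t + 1 > n. As t ≤ n -
    -- 2, the gap is nonzero and its end point lies in A.
    have h1 := hsat a (w a) (ncOrbits_apply w a) (by simp)
    have h2 := hcd y
    rw [← hy] at h2
    have hg := hgap y
    have ht0 : 0 < t := by omega
    have hym : next (block A) y ≠ y := by
      intro h
      rw [h, cd_self] at h2
      omega
    have ha1 : cd a (a + 1) = 1 := by
      have := cd_add_natCast a (show 1 < N by omega)
      simpa using this
    -- The point a + 1 is in the hull too. It comes from the point just after an element of A, so
    -- its gap is at most 1, and its image is at distance at least N - (t + 1) > n from a, outside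
    -- the hull.
    have h3 := hsat (a + 1) (w (a + 1)) (ncOrbits_apply w _) (by omega)
    obtain ⟨y', hy'⟩ := hsurj (a + 1)
    have hyA : next (block A) y ∈ A := by
      rcases rel_next (block A) y with h | h
      · exact absurd h.symm hym
      · exact h.2
    have hnext : next (block A) y' = next (block A) y + 1 := by
      have : next (block A) y' + t = next (block A) y + 1 + t := by rw [← hy', hy]; ring
      exact add_right_cancel this
    have hg' : cd y' (next (block A) y') ≤ 1 := by
      by_cases hy'm : next (block A) y' = y'
      · rw [hy'm, cd_self]
        omega
      · have hy'A : y' ∈ A ∧ next (block A) y' ∈ A := by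
          rcases rel_next (block A) y' with h | h
          · exact absurd h.symm hy'm
          · exact h
        have hrel : block A y' (next (block A) y) := Or.inr ⟨hy'A.1, hyA⟩
        by_cases hyy : next (block A) y = y'
        · rw [hnext, hyy]
          have := cd_add_natCast y' (show 1 < N by omega)
          simp only [Nat.cast_one] at this
          omega
        · have h4 := (le_cd_of_rel hrel hyy).1
          rw [hnext] at h4
          have h5 := cd_add_one y' (next (block A) y)
          have h6 := cd_lt y' (next (block A) y)
          rw [hnext]
          split_ifs at h5 <;> omega
    have h5 : cd a (w (a + 1)) = N - (cd y' (next (block A) y') + t) := by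
      have h6 := hform' y'
      rw [← hy'] at h6
      rw [h6]
      have h7 : a + 1 - ((cd y' (next (block A) y') + t + 1 : ℕ) : ZMod N) =
          a - ((cd y' (next (block A) y') + t : ℕ) : ZMod N) := by
        push_cast
        ring
      rw [h7]
      exact cd_sub_natCast _ (by omega) (by omega)
    omega
  refine nxt_eq_rot fun x y => ?_
  by_contra hxy
  rcases exists_not_symmetric hN (NC_ncOrbits w) hxy with h | h
  · exact key x h
  · exact key y h

theorem popZ_iterate_slow {n : ℕ} (hN : N = 2 * n) {A : Set (ZMod N)}
    (hA : Sym n (block A)) (hgap : ∀ x, cd x (next (block A) x) < n) {t : ℕ} (ht : t + 1 ≤ n) :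
    popZ^[t] (slow A) = slow A * (rot ^ t)⁻¹ := by
  induction t with
  | zero => simp
  | succ t ih =>
    rw [Function.iterate_succ_apply', ih (by omega), popZ,
      nxt_ncOrbits_slow_mul hN hA hgap (by omega), pow_succ', mul_inv_rev, mul_assoc]

theorem winding_rot (hN : 2 ≤ N) : winding (rot : Equiv.Perm (ZMod N)) = 1 := by
  apply le_antisymm
  · rw [rot_eq_nxt_top]
    exact winding_nxt_block_le_one _
  · rw [Nat.one_le_iff_ne_zero, ne_eq, winding_eq_zero]
    intro h
    have h1 : (0 : ZMod N) + 1 = 0 := by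
      rw [← rot_apply, h]
      rfl
    have h2 := cd_add_one (0 : ZMod N) 0
    rw [h1, cd_self] at h2
    split_ifs at h2 <;> omega

/-- The N - 3 steps split as n - 1 divisions by `rot`, each of cost one, and n - 2 steps with
displacements at most n, each of cost at most one. The initial winding is at least N - 2, so
something is left. -/
theorem popZ_iterate_slow_ne_one {n : ℕ} (hn : 2 ≤ n) (hN : N = 2 * n) {A : Set (ZMod N)}
    (hA : Sym n (block A)) (hgap : ∀ x, cd x (next (block A) x) < n) :
    popZ^[N - 3] (slow A) ≠ 1 := by
  have hwind : ∀ t, t + 1 ≤ n → winding (slow A) ≤ winding (popZ^[t] (slow A)) + t := by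
    intro t ht
    induction t with
    | zero => simp
    | succ t ih =>
      have h1 := ih (by omega)
      have h2 := winding_popZ (popZ^[t] (slow A))
      rw [Function.iterate_succ_apply']
      have h3 : winding (nxt (ncOrbits (popZ^[t] (slow A)))) = 1 := by
        rw [popZ_iterate_slow hN hA hgap (by omega),
          nxt_ncOrbits_slow_mul hN hA hgap (by omega), winding_rot (by omega)]
      omega
  have h1 := hwind (n - 1) (by omega)
  have hs : SymPerm n (popZ^[n - 1] (slow A)) := by
    have h0 : SymPerm n (slow A) := (SymPerm.rot n).inv.mul (hA.nxt hN).inv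
    generalize n - 1 = m
    induction m with
    | zero => exact h0
    | succ m ih =>
      rw [Function.iterate_succ_apply']
      exact ih.popZ hN
  -- After n - 1 divisions by `rot` the displacements are N - (gap + n).
  have hd : ∀ x, cd x ((popZ^[n - 1] (slow A)) x) ≤ n := by
    intro x
    rw [popZ_iterate_slow hN hA hgap (by omega)]
    obtain ⟨y, hy⟩ := (nxt (block A)).surjective (x - ((n - 1 : ℕ) : ZMod N))
    rw [nxt_apply] at hy
    have hx : x = next (block A) y + ((n - 1 : ℕ) : ZMod N) := by rw [hy]; ring
    have hx' : x - ((cd y (next (block A) y) + (n - 1) + 1 : ℕ) : ZMod N) = y - 1 := by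
      have := eq_add_cd y (next (block A) y)
      rw [hx]
      push_cast
      linear_combination this
    rw [Equiv.Perm.mul_apply, rot_pow_inv_apply, ← hy, slow_apply_next, ← hx']
    have := hgap y
    rw [cd_sub_natCast _ (by omega) (by omega)]
    omega
  have h2 := le_winding_iterate_of_cd_le hN hs hd (n - 2)
  rw [← Function.iterate_add_apply, show n - 2 + (n - 1) = N - 3 by omega] at h2
  have h3 := winding_slow A
  have h4 := winding_nxt_block_le_one A
  intro hcon
  rw [hcon, winding_eq_zero.2 rfl] at h2
  omega

/-- A symmetric set whose cycle has a gap of length at least `n` is an antipodal pair. -/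
theorem gap_lt {n : ℕ} (hN : N = 2 * n) {A : Set (ZMod N)} (hA : Sym n (block A))
    (hpair : ¬ ∃ a, A = {a, a + (n : ZMod N)}) (x : ZMod N) :
    cd x (next (block A) x) < n := by
  have hn : 0 < n := by have := NeZero.pos N; omega
  by_contra hcon
  have hx : next (block A) x ≠ x := fun h => by
    rw [h, cd_self] at hcon
    omega
  have hxA : x ∈ A ∧ next (block A) x ∈ A := by
    rcases rel_next (block A) x with h | h
    · exact absurd h.symm hx
    · exact h
  have hxn := cd_half hN x
  have hne : x + (n : ZMod N) ≠ x := fun h => by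
    rw [h, cd_self] at hxn
    omega
  have hnxt := (hA.nxt hN) x
  rw [nxt_apply, nxt_apply] at hnxt
  have hxA' : x + (n : ZMod N) ∈ A := by
    have h1 : next (block A) (x + (n : ZMod N)) ≠ x + (n : ZMod N) := by
      rw [hnxt]
      exact fun h => hx (add_right_cancel h)
    rcases rel_next (block A) (x + (n : ZMod N)) with h | h
    · exact absurd h.symm h1
    · exact h.1
  -- The gaps at x and x + n both have length at least n, which leaves no room for a third element
  -- of A.
  refine hpair ⟨x, ?_⟩
  ext z
  simp only [Set.mem_insert_iff, Set.mem_singleton_iff]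
  constructor
  · intro hz
    by_contra! hzz
    have h1 := (le_cd_of_rel (r := block A) (Or.inr ⟨hxA.1, hz⟩) hzz.1).1
    have h2 := (le_cd_of_rel (r := block A) (Or.inr ⟨hxA', hz⟩) hzz.2).1
    rw [hnxt, cd_add_right, cd_base x (x + n) z] at h2
    have h3 := cd_lt x z
    have h4 : cd x z ≠ cd x (x + n) := fun h => hzz.2 ((cd_right_inj x).1 h)
    split_ifs at h2 <;> omega
  · rintro (rfl | rfl)
    · exact hxA.1
    · exact hxA'

/-- Antipodal pairs do not give slow permutations. -/
theorem popZ_iterate_slow_pair {n : ℕ} (hn : 2 ≤ n) (hN : N = 2 * n) (a : ZMod N) :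
    popZ^[N - 3] (slow ({a, a + (n : ZMod N)} : Set (ZMod N))) = 1 := by
  set A : Set (ZMod N) := {a, a + (n : ZMod N)} with hAdef
  have han := cd_half hN a
  have hne : a + (n : ZMod N) ≠ a := fun h => by
    rw [h, cd_self] at han
    omega
  have haA : a ∈ A := by simp [A]
  have hanA : a + (n : ZMod N) ∈ A := by simp [A]
  have hrel : block A a (a + n) := Or.inr ⟨haA, hanA⟩
  have hna : next (block A) a = a + n := by
    refine next_eq hrel fun z hz => ?_
    rcases hz with rfl | hz
    · have := cd_lt a (a + n)
      simp only [cdp, cd_self, if_true]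
      split_ifs <;> omega
    · rcases hz.2 with rfl | hz
      · have := cd_lt z (z + n)
        simp only [cdp, cd_self, if_true]
        split_ifs <;> omega
      · rw [Set.mem_singleton_iff.1 hz]
  have hnan : next (block A) (a + n) = a := by
    have h1 : next (block A) (a + n) ≠ a + n := fun h =>
      hne (next_eq_self_iff.1 h a ((block A).symm' hrel)).symm
    rcases rel_next (block A) (a + n) with h | h
    · exact absurd h.symm h1
    · rcases h.2 with h' | h'
      · exact h'
      · exact absurd h' h1
  have hself : ∀ x, x ∉ A → next (block A) x = x := fun x hx =>
    next_eq_self_iff.2 fun y hy => by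
      rcases hy with rfl | hy
      · rfl
      · exact absurd hy.1 hx
  have hwa : slow A a = a + n - 1 := by
    have := slow_apply_next A (a + n)
    rwa [hnan] at this
  have hwan : slow A (a + n) = a - 1 := by
    have := slow_apply_next A a
    rwa [hna] at this
  have hwx : ∀ x, x ∉ A → slow A x = x - 1 := fun x hx => by
    have := slow_apply_next A x
    rwa [hself x hx] at this
  have hone : ((n - 1 : ℕ) : ZMod N) = n - 1 := by
    rw [Nat.cast_sub (by omega), Nat.cast_one]
  set o : ZMod N := a - 1 with ho
  have hoa : cd o a = 1 := by
    have := cd_add_natCast o (show 1 < N by omega)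
    rwa [Nat.cast_one, ho, sub_add_cancel] at this
  -- The permutation moves points one step back, except at a and a + n, where it jumps to the far
  -- end of the same half circle. So the half circle (o, o + n] and its complement are invariant.
  have hle : ncOrbits (slow A) ≤ cut o (o + n) := by
    refine ncOrbits_le (NC_cut _ _) fun x => ?_
    rw [cut_iff, cd_half hN o]
    have hoan : cd o (a + n) = n + 1 := by
      have := cd_add_natCast o (show n + 1 < N by omega)
      rw [← this]
      congr 1
      rw [ho]
      push_cast
      ring
    by_cases hxa : x = a
    · rw [hxa, hwa, hoa]
      have : cd o (a + n - 1) = n := by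
        have h : a + n - 1 = o + (n : ZMod N) := by rw [ho]; ring
        rw [h, cd_half hN o]
      omega
    by_cases hxan : x = a + n
    · rw [hxan, hwan, hoan, cd_self]
      omega
    · rw [hwx x (by simp [A, hxa, hxan])]
      have h1 := cd_add_one o (x - 1)
      rw [sub_add_cancel] at h1
      have h2 : cd o x ≠ cd o a := fun h => hxa ((cd_right_inj o).1 h)
      have h3 : cd o x ≠ cd o (a + n) := fun h => hxan ((cd_right_inj o).1 h)
      have h4 := cd_lt o (x - 1)
      split_ifs at h1 <;> omega
  have hmva : next (ncOrbits (slow A)) a ≠ a := by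
    rw [ne_eq, next_ncOrbits_eq_self, hwa]
    intro h
    have h1 : a + ((n - 1 : ℕ) : ZMod N) = a := by
      rw [hone]
      linear_combination h
    have h2 := cd_add_natCast a (show n - 1 < N by omega)
    rw [h1, cd_self] at h2
    omega
  have hoA : o ∉ A := by
    rintro (h | h)
    · rw [h, cd_self] at hoa
      omega
    · rw [Set.mem_singleton_iff.1 h, cd_base a (a + n) a, cd_self, han] at hoa
      split_ifs at hoa <;> omega
  have hmvo : next (ncOrbits (slow A)) o ≠ o := by
    rw [ne_eq, next_ncOrbits_eq_self, hwx o hoA]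
    intro h
    have h1 := cd_sub_natCast o (show 1 < N by omega) (by omega)
    rw [Nat.cast_one, h, cd_self] at h1
    omega
  have hoa' : next (ncOrbits (slow A)) o ≠ a := by
    intro h
    have h1 := hle (rel_next (ncOrbits (slow A)) o)
    rw [h, cut_iff, cd_self, hoa, cd_half hN o] at h1
    omega
  -- Both o and a = o + 1 have nontrivial classes, on different sides of the cut. The arc of o runs
  -- past a and the arc of a starts there, so both contain a.
  have hw2 : 2 ≤ winding (nxt (ncOrbits (slow A))) := by
    refine two_le_winding (z := a) (i := o) (j := a) ?_ ?_ ?_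
    · intro h
      rw [h, cd_self] at hoa
      omega
    · rw [nxt_apply, hoa]
      have h1 : cd o (next (ncOrbits (slow A)) o) ≠ 0 := fun h => hmvo (cd_eq_zero.1 h).symm
      have h2 : cd o (next (ncOrbits (slow A)) o) ≠ cd o a := fun h =>
        hoa' ((cd_right_inj o).1 h)
      omega
    · rw [nxt_apply, cd_self]
      exact Nat.pos_of_ne_zero fun h => hmva (cd_eq_zero.1 h).symm
  -- The winding of `slow A` is at most N - 2. The first step removes at least two, and the other N
  -- - 4 steps remove the rest.
  have h1 := winding_popZ (slow A)
  have h2 := winding_slow A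
  have h3 := winding_popZ_iterate (popZ (slow A)) (N - 4)
  rw [← Function.iterate_succ_apply, show (N - 4).succ = N - 3 by omega] at h3
  have h4 : winding (nxt (block A)) ≠ 0 := by
    rw [ne_eq, winding_eq_zero]
    intro h
    have : next (block A) a = a := by rw [← nxt_apply, h]; rfl
    exact hne (hna ▸ this)
  exact winding_eq_zero.1 (by omega)

end Symmetric

section Count

variable {N : ℕ} [NeZero N]

/-! ### Counting slow permutations -/

/-- The subset of `ZMod (2 n)` consisting of the points whose residue modulo `n` lies in `B`. -/
def residueSet (N n : ℕ) (B : Finset ℕ) : Set (ZMod N) := {x | x.val % n ∈ B}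

theorem mem_residueSet {n : ℕ} {B : Finset ℕ} {x : ZMod N} :
    x ∈ residueSet N n B ↔ x.val % n ∈ B := Iff.rfl

theorem val_add_half_mod {n : ℕ} (hN : N = 2 * n) (x : ZMod N) :
    (x + (n : ZMod N)).val % n = x.val % n := by
  have hn : n < N := by have := NeZero.pos N; omega
  rw [ZMod.val_add, ZMod.val_natCast, Nat.mod_eq_of_lt hn, Nat.mod_mod_of_dvd _ ⟨2, by omega⟩,
    Nat.add_mod_right]

theorem sym_block {n : ℕ} {A : Set (ZMod N)} (h : ∀ x ∈ A, x + (n : ZMod N) ∈ A) :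
    Sym n (block A) := by
  rintro x y (rfl | hxy)
  · exact Or.inl rfl
  · exact Or.inr ⟨h x hxy.1, h y hxy.2⟩

theorem residueSet_add {n : ℕ} (hN : N = 2 * n) {B : Finset ℕ} {x : ZMod N}
    (hx : x ∈ residueSet N n B) : x + (n : ZMod N) ∈ residueSet N n B := by
  rwa [mem_residueSet, val_add_half_mod hN]

theorem add_half_ne {n : ℕ} (hN : N = 2 * n) (x : ZMod N) : x + (n : ZMod N) ≠ x := fun h => by
  have h1 := cd_half hN x
  rw [h, cd_self] at h1
  have := NeZero.pos N
  omega

theorem eq_mod_or_eq_mod_add {n : ℕ} (hN : N = 2 * n) (x : ZMod N) :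
    x = ((x.val % n : ℕ) : ZMod N) ∨ x = ((x.val % n : ℕ) : ZMod N) + n := by
  have h1 := ZMod.val_lt x
  have h2 := Nat.mod_add_div x.val n
  have h3 : x.val / n < 2 := Nat.div_lt_of_lt_mul (by omega)
  have hx : x = (x.val : ZMod N) := (ZMod.natCast_zmod_val x).symm
  interval_cases h : x.val / n
  · left
    rw [mul_zero, add_zero] at h2
    rwa [h2]
  · right
    rw [mul_one] at h2
    rw [← Nat.cast_add, h2]
    exact hx

theorem val_mod_natCast {n : ℕ} (hN : N = 2 * n) {i : ℕ} (hi : i < n) :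
    ((i : ZMod N)).val % n = i := by
  rw [ZMod.val_natCast, Nat.mod_eq_of_lt (show i < N by omega), Nat.mod_eq_of_lt hi]

theorem residueSet_singleton {n : ℕ} (hN : N = 2 * n) {i : ℕ} (hi : i < n) :
    residueSet N n {i} = {(i : ZMod N), (i : ZMod N) + n} := by
  ext x
  rw [mem_residueSet, Finset.mem_singleton, Set.mem_insert_iff, Set.mem_singleton_iff]
  constructor
  · intro h
    rcases eq_mod_or_eq_mod_add hN x with h' | h' <;> rw [h] at h'
    · exact Or.inl h'
    · exact Or.inr h'
  · rintro (rfl | rfl)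
    · exact val_mod_natCast hN hi
    · rw [val_add_half_mod hN]
      exact val_mod_natCast hN hi

theorem card_eq_one_of_residueSet {n : ℕ} (hN : N = 2 * n) {B : Finset ℕ}
    (hB : B ⊆ Finset.range n) {a : ZMod N} (h : residueSet N n B = {a, a + (n : ZMod N)}) :
    B.card = 1 := by
  rw [Finset.card_eq_one]
  refine ⟨a.val % n, ?_⟩
  ext i
  rw [Finset.mem_singleton]
  constructor
  · intro hi
    have hin := Finset.mem_range.1 (hB hi)
    have h1 : (i : ZMod N) ∈ residueSet N n B := by
      rwa [mem_residueSet, val_mod_natCast hN hin]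
    rw [h] at h1
    rw [← val_mod_natCast hN hin]
    rcases h1 with h1 | h1
    · rw [h1]
    · rw [Set.mem_singleton_iff.1 h1, val_add_half_mod hN]
  · rintro rfl
    rw [← mem_residueSet, h]
    exact Or.inl rfl

theorem exists_residueSet_eq {n : ℕ} (hN : N = 2 * n) {A : Set (ZMod N)}
    (hA : ∀ x, x + (n : ZMod N) ∈ A ↔ x ∈ A) :
    ∃ B ⊆ Finset.range n, residueSet N n B = A := by
  classical
  refine ⟨(Finset.range n).filter fun i => (i : ZMod N) ∈ A, Finset.filter_subset _ _, ?_⟩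
  have hn : 0 < n := by have := NeZero.pos N; omega
  ext x
  rw [mem_residueSet, Finset.mem_filter, Finset.mem_range]
  rcases eq_mod_or_eq_mod_add hN x with h | h
  · rw [← h]
    simp [Nat.mod_lt _ hn]
  · nth_rewrite 3 [h]
    rw [hA]
    simp [Nat.mod_lt _ hn]

/-- A residue set contains the antipode of each of its points, so it is never a singleton and can be
read off from its cycle; hence distinct B give distinct permutations. -/
theorem setOf_nxt_block_residueSet {n : ℕ} (hN : N = 2 * n) (B : Finset ℕ) :
    {x | nxt (block (residueSet N n B)) x ≠ x} = residueSet N n B :=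
  setOf_nxt_block_ne fun a ha => ⟨a + n, residueSet_add hN ha, add_half_ne hN a⟩

theorem slow_residueSet_injOn {n : ℕ} (hN : N = 2 * n) :
    Set.InjOn (fun B => slow (residueSet N n B)) {B : Finset ℕ | B ⊆ Finset.range n} := by
  intro B hB C hC h
  have h1 : nxt (block (residueSet N n B)) = nxt (block (residueSet N n C)) := by
    simpa [slow] using h
  have h2 : residueSet N n B = residueSet N n C := by
    rw [← setOf_nxt_block_residueSet hN, h1, setOf_nxt_block_residueSet hN]
  have h3 : ∀ B : Finset ℕ, B ⊆ Finset.range n → ∀ i,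
      i ∈ B ↔ i < n ∧ (i : ZMod N) ∈ residueSet N n B := by
    intro B hB i
    constructor
    · intro hi
      have hin := Finset.mem_range.1 (hB hi)
      exact ⟨hin, by rwa [mem_residueSet, val_mod_natCast hN hin]⟩
    · rintro ⟨hin, hi⟩
      rwa [mem_residueSet, val_mod_natCast hN hin] at hi
  ext i
  rw [h3 B hB, h3 C hC, h2]

theorem card_filter_powerset_range (n : ℕ) :
    ((Finset.range n).powerset.filter fun B => B.card ≠ 1).card = 2 ^ n - n := by
  have h := Finset.card_filter_add_card_filter_not (s := (Finset.range n).powerset)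
    fun B => B.card = 1
  rw [← Finset.powersetCard_eq_filter, Finset.card_powersetCard, Finset.card_powerset,
    Finset.card_range, Nat.choose_one_right] at h
  simp only [ne_eq]
  omega

/-- Half-turn-invariant subsets correspond to sets of residues modulo n, and antipodal pairs to the
singletons, which are the excluded case. -/
theorem setOf_slow_eq {n : ℕ} (hn : 2 ≤ n) (hN : N = 2 * n) :
    {w : Equiv.Perm (ZMod N) | SymPerm n w ∧ popZ^[N - 3] w ≠ 1} =
      (fun B => slow (residueSet N n B)) ''
        ((Finset.range n).powerset.filter fun B => B.card ≠ 1 : Finset (Finset ℕ)) := by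
  ext w
  simp only [Set.mem_ofPred_eq, Set.mem_image, Finset.coe_filter, Finset.mem_powerset]
  constructor
  · rintro ⟨hw, hne⟩
    have hwind : N ≤ winding w + 2 := by
      by_contra hlt
      have h1 := winding_popZ_iterate w (N - 3)
      exact hne (winding_eq_zero.1 (by omega))
    have hslow := eq_slow_of_le_winding hwind
    have hsym : SymPerm n (rot * w : Equiv.Perm (ZMod N))⁻¹ := ((SymPerm.rot n).mul hw).inv
    obtain ⟨B, hB, hBA⟩ := exists_residueSet_eq hN
      (A := {x | (rot * w : Equiv.Perm (ZMod N))⁻¹ x ≠ x}) fun x => by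
        simp only [Set.mem_ofPred_eq, ne_eq]
        rw [hsym x, add_left_inj]
    refine ⟨B, ⟨hB, fun hcard => hne ?_⟩, by rw [hBA, ← hslow]⟩
    obtain ⟨i, rfl⟩ := Finset.card_eq_one.1 hcard
    have hi : i < n := by simpa using hB
    rw [hslow, ← hBA, residueSet_singleton hN hi]
    exact popZ_iterate_slow_pair hn hN _
  · rintro ⟨B, ⟨hB, hcard⟩, rfl⟩
    have hs : Sym n (block (residueSet N n B)) := sym_block fun x hx => residueSet_add hN hx
    refine ⟨(SymPerm.rot n).inv.mul (hs.nxt hN).inv, ?_⟩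
    refine popZ_iterate_slow_ne_one hn hN hs (gap_lt hN hs ?_)
    rintro ⟨a, ha⟩
    exact hcard (card_eq_one_of_residueSet hN hB ha)

theorem ncard_slow {n : ℕ} (hn : 2 ≤ n) (hN : N = 2 * n) :
    {w : Equiv.Perm (ZMod N) | SymPerm n w ∧ popZ^[N - 3] w ≠ 1}.ncard = 2 ^ n - n := by
  rw [setOf_slow_eq hn hN, Set.InjOn.ncard_image, Set.ncard_coe_finset,
    card_filter_powerset_range]
  intro B hB C hC h
  refine slow_residueSet_injOn hN ?_ ?_ h
  · simpa using (Finset.mem_filter.1 hB).1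
  · simpa using (Finset.mem_filter.1 hC).1

theorem popZ_iterate_eq_one_of_le {w : Equiv.Perm (ZMod N)} {k m : ℕ} (hkm : k ≤ m)
    (h : popZ^[k] w = 1) : popZ^[m] w = 1 := by
  obtain ⟨d, rfl⟩ := Nat.exists_eq_add_of_le' hkm
  rw [Function.iterate_add_apply, h, popZ_iterate_one]

/-- The identity is reached within N - 1 steps and is then kept, so the least exponent is one of the
last two values exactly when N - 3 steps fail. -/
theorem isLeast_iterate_iff (hN : 3 ≤ N) (w : Equiv.Perm (ZMod N)) :
    (IsLeast {m : ℕ | popZ^[m] w = 1} (N - 2) ∨ IsLeast {m : ℕ | popZ^[m] w = 1} (N - 1)) ↔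
      popZ^[N - 3] w ≠ 1 := by
  have hlast : popZ^[N - 1] w = 1 := by
    have h1 := winding_popZ_iterate w (N - 1)
    have h2 := winding_add_winding_inv w
    exact winding_eq_zero.1 (by omega)
  constructor
  · rintro (h | h) hcon
    · have := h.2 hcon
      omega
    · have := h.2 hcon
      omega
  · intro hne
    have hlow : ∀ m, popZ^[m] w = 1 → N - 2 ≤ m := by
      intro m hm
      by_contra hlt
      exact hne (popZ_iterate_eq_one_of_le (by omega) hm)
    by_cases h : popZ^[N - 2] w = 1
    · exact Or.inl ⟨h, hlow⟩
    · refine Or.inr ⟨hlast, fun m hm => ?_⟩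
      have h1 := hlow m hm
      have h2 : m ≠ N - 2 := by
        rintro rfl
        exact h hm
      omega

end Count

section Reflections

variable {n : ℕ}

/-! ### Reflections of the hyperoctahedral group -/

@[simp] theorem bar_bar (x : SignedPoint n) : bar (bar x) = x := by simp [bar]

theorem bar_ne (x : SignedPoint n) : bar x ≠ x := by simp [bar, Prod.ext_iff]

theorem bar_inj {x y : SignedPoint n} : bar x = bar y ↔ x = y :=
  ⟨fun h => by rw [← bar_bar x, h, bar_bar], fun h => by rw [h]⟩

theorem bar_eq_iff {x y : SignedPoint n} : bar x = y ↔ x = bar y :=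
  ⟨fun h => by rw [← h, bar_bar], fun h => by rw [h, bar_bar]⟩

theorem apply_bar (w : Hyperoctahedral n) (x : SignedPoint n) : w.1 (bar x) = bar (w.1 x) :=
  w.2 x

/-- The map underlying the reflection exchanging `i` with `j` and `bar i` with `bar j`. -/
def reflFun (i j x : SignedPoint n) : SignedPoint n :=
  if x = i then j else if x = j then i else if x = bar i then bar j
    else if x = bar j then bar i else x

theorem reflFun_involutive (i j : SignedPoint n) : Function.Involutive (reflFun i j) := by
  intro x
  have h1 := bar_ne i
  have h2 := bar_ne j
  have h3 : bar i = bar j ↔ i = j := bar_inj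
  have h4 : bar i = j ↔ i = bar j := bar_eq_iff
  unfold reflFun
  grind

theorem reflFun_bar (i j x : SignedPoint n) : reflFun i j (bar x) = bar (reflFun i j x) := by
  have h1 := bar_ne i
  have h2 := bar_ne j
  have h3 : bar x = i ↔ x = bar i := bar_eq_iff
  have h4 : bar x = j ↔ x = bar j := bar_eq_iff
  have h5 : bar x = bar i ↔ x = i := bar_inj
  have h6 : bar x = bar j ↔ x = j := bar_inj
  have h7 := bar_bar i
  have h8 := bar_bar j
  unfold reflFun
  grind

/-- The reflection exchanging `i` with `j` and `bar i` with `bar j`. -/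
def refl (i j : SignedPoint n) : Hyperoctahedral n :=
  ⟨(reflFun_involutive i j).toPerm, reflFun_bar i j⟩

theorem refl_apply (i j x : SignedPoint n) : (refl i j).1 x = reflFun i j x := rfl

@[simp] theorem refl_apply_left (i j : SignedPoint n) : (refl i j).1 i = j := by
  simp [refl_apply, reflFun]

@[simp] theorem refl_apply_right (i j : SignedPoint n) : (refl i j).1 j = i := by
  have h := reflFun_involutive i j i
  rwa [← refl_apply, ← refl_apply, refl_apply_left] at h

theorem refl_apply_of_ne {i j x : SignedPoint n} (h1 : x ≠ i) (h2 : x ≠ j) (h3 : x ≠ bar i)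
    (h4 : x ≠ bar j) : (refl i j).1 x = x := by
  simp [refl_apply, reflFun, h1, h2, h3, h4]

theorem hyperoctahedral_ext {u v : Hyperoctahedral n} (h : ∀ x, u.1 x = v.1 x) : u = v :=
  Subtype.ext (Equiv.ext h)

theorem mul_apply (u v : Hyperoctahedral n) (x : SignedPoint n) :
    (u * v).1 x = u.1 (v.1 x) := rfl

theorem refl_mul_refl (i j : SignedPoint n) : refl i j * refl i j = 1 :=
  hyperoctahedral_ext fun x => reflFun_involutive i j x

theorem refl_inv (i j : SignedPoint n) : (refl i j)⁻¹ = refl i j :=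
  inv_eq_of_mul_eq_one_left (refl_mul_refl i j)

theorem mul_refl (w : Hyperoctahedral n) (i j : SignedPoint n) :
    w * refl i j = refl (w.1 i) (w.1 j) * w := by
  refine hyperoctahedral_ext fun x => ?_
  rw [mul_apply, mul_apply, refl_apply, refl_apply, reflFun, reflFun]
  simp only [← apply_bar, EmbeddingLike.apply_eq_iff_eq]
  split_ifs <;> rfl

theorem signChange_eq (i : Fin n) : signChange i = refl (i, false) (i, true) := by
  refine hyperoctahedral_ext fun x => ?_
  rw [refl_apply, reflFun]
  change Equiv.swap (i, false) (i, true) x = _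
  rw [Equiv.swap_apply_def]
  simp only [bar, Bool.not_false, Bool.not_true]
  split_ifs <;> rfl

theorem liftPerm_swap (i j : Fin n) :
    liftPerm (Equiv.swap i j) = refl (i, false) (j, false) := by
  refine hyperoctahedral_ext fun x => ?_
  obtain ⟨k, b⟩ := x
  rw [refl_apply, reflFun]
  change (Equiv.swap i j k, b) = _
  rw [Equiv.swap_apply_def]
  cases b <;> simp [bar] <;> split_ifs <;> rfl

theorem exists_refl_eq_simpleReflection (i : Fin n) :
    ∃ a b, a ≠ b ∧ simpleReflection i = refl a b := by
  unfold simpleReflection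
  split_ifs with h
  · exact ⟨_, _, by simp, signChange_eq i⟩
  · refine ⟨_, _, ?_, liftPerm_swap _ _⟩
    simp only [ne_eq, Prod.mk.injEq, and_true, Fin.ext_iff]
    omega

theorem mem_reflections_iff {t : Hyperoctahedral n} :
    t ∈ reflections (simpleReflections n) ↔ ∃ i j, i ≠ j ∧ t = refl i j := by
  constructor
  · rintro ⟨w, -, ⟨s, rfl⟩, rfl⟩
    obtain ⟨a, b, hab, h⟩ := exists_refl_eq_simpleReflection s
    refine ⟨w.1 a, w.1 b, fun h => hab (w.1.injective h), ?_⟩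
    rw [h, mul_refl, mul_inv_cancel_right]
  · rintro ⟨i, j, hij, rfl⟩
    have hn : 0 < n := lt_of_le_of_lt (Nat.zero_le _) i.1.isLt
    let o : SignedPoint n := (⟨0, hn⟩, false)
    by_cases hj : j = bar i
    · refine ⟨refl o i, simpleReflection ⟨0, hn⟩, ⟨_, rfl⟩, ?_⟩
      have h : simpleReflection (⟨0, hn⟩ : Fin n) = refl o (bar o) := by
        rw [simpleReflection, if_pos rfl, signChange_eq]
        rfl
      rw [h, mul_refl, apply_bar, mul_inv_cancel_right, refl_apply_left, hj]
    · have hne : i.1 ≠ j.1 := by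
        intro h
        obtain ⟨p, b⟩ := i
        obtain ⟨q, b'⟩ := j
        simp only at h
        subst h
        cases b <;> cases b' <;> simp_all [bar]
      have hn2 : 1 < n := by
        have h1 := i.1.isLt
        have h2 := j.1.isLt
        have h3 : i.1.val ≠ j.1.val := fun h => hne (Fin.ext h)
        omega
      let q : SignedPoint n := (⟨1, hn2⟩, false)
      have hoq : o ≠ q := by simp [o, q]
      have hoq' : o ≠ bar q := by simp [o, q, bar]
      -- Conjugation by `refl q j'` sends the pair (o, q) to (o, j'), and conjugation by `refl o i`
      -- sends this to (i, j).
      set j' := (refl o i).1 j with hj'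
      have hj1 : o ≠ j' := by
        intro h
        have h1 : (refl o i).1 i = (refl o i).1 j := by rw [refl_apply_right]; exact h
        exact hij ((refl o i).1.injective h1)
      have hj2 : o ≠ bar j' := by
        intro h
        rw [hj', ← apply_bar] at h
        have h1 : (refl o i).1 i = (refl o i).1 (bar j) := by rw [refl_apply_right]; exact h
        have h2 := (refl o i).1.injective h1
        exact hj (by rw [h2, bar_bar])
      have hback : (refl o i).1 j' = j := reflFun_involutive o i j
      refine ⟨refl o i * refl q j', simpleReflection ⟨1, hn2⟩, ⟨_, rfl⟩, ?_⟩
      have h : simpleReflection (⟨1, hn2⟩ : Fin n) = refl o q := by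
        rw [simpleReflection, if_neg (by simp)]
        exact liftPerm_swap _ _
      rw [h, mul_refl, mul_inv_cancel_right, mul_apply, mul_apply, refl_apply_left,
        refl_apply_of_ne hoq hj1 hoq' hj2, refl_apply_left, hback]

/-! ### The moved space of a signed permutation -/

/-- The vector `e_x - e_{bar x}`. -/
def root (x : SignedPoint n) : SignedPoint n → ℚ := Pi.single x 1 - Pi.single (bar x) 1

theorem root_apply (x z : SignedPoint n) :
    root x z = (if z = x then 1 else 0) - if z = bar x then 1 else 0 := by
  simp [root, Pi.single_apply]

theorem root_bar (x : SignedPoint n) : root (bar x) = -root x := by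
  simp [root]

theorem root_apply_bar (x z : SignedPoint n) : root x (bar z) = -root x z := by
  have h : bar z = x ↔ z = bar x := bar_eq_iff
  simp only [root_apply, bar_inj, h]
  ring

theorem root_apply_self (x : SignedPoint n) : root x x = 1 := by
  simp [root_apply, (bar_ne x).symm]

theorem root_apply_map (w : Hyperoctahedral n) (x z : SignedPoint n) :
    root (w.1 x) (w.1 z) = root x z := by
  simp [root_apply, ← apply_bar]

theorem root_apply_comm (x z : SignedPoint n) : root x z = root z x := by
  rw [root_apply, root_apply]
  congr 1
  · exact if_congr eq_comm rfl rfl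
  · exact if_congr (by rw [eq_comm, bar_eq_iff]) rfl rfl

theorem root_injective {x y : SignedPoint n} (h : root x = root y) : x = y := by
  have h1 := congrFun h x
  rw [root_apply_self, root_apply] at h1
  split_ifs at h1 with h2 <;> first | exact h2 | norm_num at h1

theorem sum_mul_root (f : SignedPoint n → ℚ) (x : SignedPoint n) :
    ∑ z, f z * root x z = f x - f (bar x) := by
  simp [root_apply, mul_sub]

/-- The span of the vectors `w v - v`, for `v` running over the vectors `e_x - e_{bar x}`. -/
def moved (w : Hyperoctahedral n) : Submodule ℚ (SignedPoint n → ℚ) :=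
  Submodule.span ℚ (Set.range fun x => root (w.1 x) - root x)

/-- The dimension of the moved space. -/
noncomputable def movedRank (w : Hyperoctahedral n) : ℕ := Module.finrank ℚ (moved w)

theorem sub_mem_moved (w : Hyperoctahedral n) (x : SignedPoint n) :
    root (w.1 x) - root x ∈ moved w := Submodule.subset_span ⟨x, rfl⟩

theorem moved_le {w : Hyperoctahedral n} {M : Submodule ℚ (SignedPoint n → ℚ)}
    (h : ∀ x, root (w.1 x) - root x ∈ M) : moved w ≤ M :=
  Submodule.span_le.2 (by rintro _ ⟨x, rfl⟩; exact h x)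

theorem moved_mul_le (u v : Hyperoctahedral n) : moved (u * v) ≤ moved u ⊔ moved v := by
  refine moved_le fun x => ?_
  have h : root ((u * v).1 x) - root x =
      (root (u.1 (v.1 x)) - root (v.1 x)) + (root (v.1 x) - root x) := by
    rw [mul_apply]; abel
  rw [h]
  exact Submodule.add_mem_sup (sub_mem_moved u _) (sub_mem_moved v _)

theorem movedRank_sup_le (u v : Hyperoctahedral n) :
    Module.finrank ℚ ↥(moved u ⊔ moved v) ≤ movedRank u + movedRank v :=
  Submodule.finrank_add_le_finrank_add_finrank _ _

theorem movedRank_mul_le (u v : Hyperoctahedral n) :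
    movedRank (u * v) ≤ movedRank u + movedRank v :=
  (Submodule.finrank_mono (moved_mul_le u v)).trans (movedRank_sup_le u v)

/-- If lengths add up, then so do the moved spaces. -/
theorem moved_mul_eq {u v : Hyperoctahedral n} (h : movedRank u + movedRank v ≤ movedRank (u * v)) :
    moved (u * v) = moved u ⊔ moved v :=
  Submodule.eq_of_le_of_finrank_le (moved_mul_le u v) ((movedRank_sup_le u v).trans h)

theorem moved_refl_le (i j : SignedPoint n) : moved (refl i j) ≤ ℚ ∙ (root j - root i) := by
  refine moved_le fun x => ?_
  have hm := Submodule.mem_span_singleton_self (R := ℚ) (root j - root i)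
  have hm' : root i - root j ∈ ℚ ∙ (root j - root i) := by
    rw [← neg_sub (root j) (root i)]
    exact Submodule.neg_mem _ hm
  rw [refl_apply, reflFun]
  split_ifs with h1 h2 h3 h4
  · rwa [h1]
  · rwa [h2]
  · rwa [h3, root_bar, root_bar, neg_sub_neg]
  · rw [h4, root_bar, root_bar, neg_sub_neg]
    exact hm
  · simp

theorem movedRank_refl_le (i j : SignedPoint n) : movedRank (refl i j) ≤ 1 :=
  (Submodule.finrank_mono (moved_refl_le i j)).trans ((finrank_span_le_card _).trans (by simp))

theorem movedRank_one : movedRank (1 : Hyperoctahedral n) = 0 := by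
  have : moved (1 : Hyperoctahedral n) = ⊥ := le_bot_iff.1 (moved_le fun x => by simp)
  rw [movedRank, this, finrank_bot]

theorem movedRank_eq_zero {w : Hyperoctahedral n} : movedRank w = 0 ↔ w = 1 := by
  constructor
  · intro h
    have hb : moved w = ⊥ := Submodule.finrank_eq_zero.1 h
    refine hyperoctahedral_ext fun x => ?_
    have := sub_mem_moved w x
    rw [hb, Submodule.mem_bot, sub_eq_zero] at this
    exact root_injective this
  · rintro rfl
    exact movedRank_one

/-- Functions invariant under w are orthogonal to the moved space; this is how non-membership is
detected below. -/
theorem sum_mul_eq_zero_of_mem_moved {w : Hyperoctahedral n} {f : SignedPoint n → ℚ}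
    (hf : ∀ x, f (w.1 x) = f x) {m : SignedPoint n → ℚ} (hm : m ∈ moved w) :
    ∑ z, f z * m z = 0 := by
  induction hm using Submodule.span_induction with
  | mem m h =>
    obtain ⟨x, rfl⟩ := h
    simp only [Pi.sub_apply, mul_sub, Finset.sum_sub_distrib]
    rw [sum_mul_root, sum_mul_root, ← apply_bar, hf, hf, sub_self]
  | zero => simp
  | add a b _ _ ha hb => simp [mul_add, Finset.sum_add_distrib, ha, hb]
  | smul c a _ ha =>
    have : ∑ z, f z * (c • a) z = c * ∑ z, f z * a z := by
      rw [Finset.mul_sum]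
      exact Finset.sum_congr rfl fun z _ => by simp only [Pi.smul_apply, smul_eq_mul]; ring
    rw [this, ha, mul_zero]

/-- The moved space is the image of w - 1 on odd functions: m is the translate of y by w minus y. -/
theorem exists_of_mem_moved {w : Hyperoctahedral n} {m : SignedPoint n → ℚ} (hm : m ∈ moved w) :
    ∃ y : SignedPoint n → ℚ, (∀ z, y (bar z) = -y z) ∧ ∀ z, y z - y (w.1 z) = m (w.1 z) := by
  induction hm using Submodule.span_induction with
  | mem m h =>
    obtain ⟨x, rfl⟩ := h
    refine ⟨root x, root_apply_bar x, fun z => ?_⟩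
    simp only [Pi.sub_apply, root_apply_map]
  | zero => exact ⟨0, by simp, by simp⟩
  | add a b _ _ ha hb =>
    obtain ⟨y, h1, h2⟩ := ha
    obtain ⟨y', h1', h2'⟩ := hb
    refine ⟨y + y', fun z => ?_, fun z => ?_⟩
    · simp only [Pi.add_apply, h1, h1']; ring
    · simp only [Pi.add_apply, ← h2, ← h2']; ring
  | smul c a _ ha =>
    obtain ⟨y, h1, h2⟩ := ha
    refine ⟨c • y, fun z => ?_, fun z => ?_⟩
    · simp only [Pi.smul_apply, h1, smul_eq_mul]; ring
    · simp only [Pi.smul_apply, ← h2, smul_eq_mul]; ring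

/-- Multiplication by a reflection whose root lies in the moved space lowers the rank. -/
theorem movedRank_refl_mul_lt {w : Hyperoctahedral n} {i j : SignedPoint n} (hij : i ≠ j)
    (h : root j - root i ∈ moved w) : movedRank (refl i j * w) < movedRank w := by
  obtain ⟨y, hodd, hy⟩ := exists_of_mem_moved h
  set δ : ℚ := if j = bar i then 1 else 0 with hδ
  have hδ0 : 0 ≤ δ := by rw [hδ]; split_ifs <;> norm_num
  have hri : root i j = -δ := by
    rw [root_apply, if_neg hij.symm, hδ]; ring
  have hrj : root j i = -δ := by rw [root_apply_comm, hri]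
  -- With m = root j - root i, the vectors y and y + m have equal norm, which forces y + m to be the
  -- mirror image of y under the reflection. Hence y is fixed by `refl i j * w`.
  have hsq : ∑ z, (y (w.1 z) + (root j - root i) (w.1 z)) ^ 2 = ∑ z, y z ^ 2 :=
    Finset.sum_congr rfl fun z _ => by rw [← hy]; ring
  rw [Equiv.sum_comp w.1 fun z => (y z + (root j - root i) z) ^ 2] at hsq
  have hpair : ∀ f : SignedPoint n → ℚ, ∑ z, f z * (root j - root i) z =
      (f j - f (bar j)) - (f i - f (bar i)) := by
    intro f
    simp only [Pi.sub_apply, mul_sub, Finset.sum_sub_distrib]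
    rw [sum_mul_root, sum_mul_root]
  have hexp : ∑ z, (y z + (root j - root i) z) ^ 2 = ∑ z, y z ^ 2 +
      2 * ∑ z, y z * (root j - root i) z +
      ∑ z, (root j - root i) z * (root j - root i) z := by
    rw [Finset.mul_sum, ← Finset.sum_add_distrib, ← Finset.sum_add_distrib]
    exact Finset.sum_congr rfl fun z _ => by ring
  have hval : y j - y i = -(1 + δ) := by
    rw [hexp, hpair, hpair] at hsq
    simp only [Pi.sub_apply, hodd, root_apply_bar, root_apply_self, hri, hrj] at hsq
    linarith
  have hyt : ∀ z, y z + (root j - root i) z = y ((refl i j).1 z) := by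
    intro z
    rw [refl_apply, reflFun, Pi.sub_apply]
    split_ifs with h1 h2 h3 h4
    · rw [h1, root_apply_self, hrj]; linarith
    · rw [h2, root_apply_self, hri]; linarith
    · rw [h3, root_apply_bar, root_apply_bar, root_apply_self, hrj, hodd, hodd]; linarith
    · rw [h4, root_apply_bar, root_apply_bar, root_apply_self, hri, hodd, hodd]; linarith
    · simp [root_apply, h1, h2, h3, h4]
  have hinv : ∀ x, y ((refl i j * w).1 x) = y x := by
    intro x
    rw [mul_apply, ← hyt, ← hy]
    ring
  have hle : moved (refl i j * w) ≤ moved w :=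
    (moved_mul_le _ _).trans (sup_le ((moved_refl_le i j).trans
      (by rwa [Submodule.span_singleton_le_iff_mem])) le_rfl)
  -- If the rank did not drop, root j - root i would be orthogonal to the invariant y, but their
  -- pairing is 2(y j - y i) = -2(1 + δ).
  refine Submodule.finrank_lt_finrank_of_lt (lt_of_le_of_ne hle fun heq => ?_)
  rw [← heq] at h
  have h0 := sum_mul_eq_zero_of_mem_moved hinv h
  rw [hpair, hodd, hodd] at h0
  linarith

theorem movedRank_mul_refl_lt {w : Hyperoctahedral n} {i j : SignedPoint n} (hij : i ≠ j)
    (h : root j - root i ∈ moved w) : movedRank (w * refl i j) < movedRank w := by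
  rw [mul_refl]
  refine movedRank_refl_mul_lt (fun h => hij (w.1.injective h)) ?_
  have h1 : root (w.1 j) - root (w.1 i) =
      (root (w.1 j) - root j) - (root (w.1 i) - root i) + (root j - root i) := by abel
  rw [h1]
  exact add_mem (sub_mem (sub_mem_moved w j) (sub_mem_moved w i)) h

theorem exists_refl_of_ne_one {w : Hyperoctahedral n} (hw : w ≠ 1) :
    ∃ i j, i ≠ j ∧ root j - root i ∈ moved w := by
  by_contra! hcon
  exact hw (hyperoctahedral_ext fun x => by
    by_contra hx
    exact hcon x (w.1 x) (Ne.symm hx) (sub_mem_moved w x))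

/-! ### The absolute length -/

theorem exists_list_reflections (w : Hyperoctahedral n) :
    ∃ l : List (Hyperoctahedral n), (∀ t ∈ l, t ∈ reflections (simpleReflections n)) ∧
      l.length ≤ movedRank w ∧ l.prod = w := by
  induction hk : movedRank w using Nat.strong_induction_on generalizing w with
  | _ k ih =>
    by_cases hw : w = 1
    · exact ⟨[], by simp, by simp, by simp [hw]⟩
    · obtain ⟨i, j, hij, hm⟩ := exists_refl_of_ne_one hw
      have hlt := movedRank_refl_mul_lt hij hm
      obtain ⟨l, hl, hlen, hprod⟩ := ih _ (hk ▸ hlt) _ rfl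
      refine ⟨refl i j :: l, ?_, ?_, ?_⟩
      · intro t ht
        rcases List.mem_cons.1 ht with rfl | ht
        · exact mem_reflections_iff.2 ⟨i, j, hij, rfl⟩
        · exact hl t ht
      · rw [List.length_cons]
        omega
      · rw [List.prod_cons, hprod, ← mul_assoc, refl_mul_refl, one_mul]

theorem movedRank_prod_le (l : List (Hyperoctahedral n))
    (hl : ∀ t ∈ l, t ∈ reflections (simpleReflections n)) : movedRank l.prod ≤ l.length := by
  induction l with
  | nil => simp [movedRank_one]
  | cons t l ih =>
    rw [List.prod_cons, List.length_cons]
    obtain ⟨i, j, -, rfl⟩ := mem_reflections_iff.1 (hl t (by simp))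
    have h1 := movedRank_mul_le (refl i j) l.prod
    have h2 := movedRank_refl_le i j
    have h3 := ih fun t ht => hl t (by simp [ht])
    omega

/-- Carter's lemma: a reflection changes the rank of the moved space by at most one, and a
reflection whose root lies in it always lowers the rank. -/
theorem absLength_eq (w : Hyperoctahedral n) :
    absLength (simpleReflections n) w = movedRank w := by
  obtain ⟨l, hl, hlen, hprod⟩ := exists_list_reflections w
  apply le_antisymm
  · refine le_trans (Nat.sInf_le ?_) hlen
    exact ⟨l, hl, rfl, hprod⟩
  · rw [absLength]
    refine le_csInf ?_ ?_
    · exact ⟨_, l, hl, rfl, hprod⟩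
    rintro k ⟨l', hl', rfl, rfl⟩
    exact movedRank_prod_le l' hl'

theorem absLE_iff {u v : Hyperoctahedral n} :
    AbsLE (simpleReflections n) u v ↔ movedRank v = movedRank u + movedRank (u⁻¹ * v) := by
  rw [AbsLE, absLength_eq, absLength_eq, absLength_eq]

theorem one_absLE (w : Hyperoctahedral n) : AbsLE (simpleReflections n) 1 w := by
  rw [absLE_iff, movedRank_one]
  simp

theorem absLE_refl (w : Hyperoctahedral n) : AbsLE (simpleReflections n) w w := by
  rw [absLE_iff, inv_mul_cancel, movedRank_one, add_zero]

theorem absLE_antisymm {u v : Hyperoctahedral n} (h1 : AbsLE (simpleReflections n) u v)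
    (h2 : AbsLE (simpleReflections n) v u) : u = v := by
  rw [absLE_iff] at h1 h2
  have h : movedRank (u⁻¹ * v) = 0 := by omega
  exact inv_mul_eq_one.1 (movedRank_eq_zero.1 h)

theorem absLE_trans {u v w : Hyperoctahedral n} (h1 : AbsLE (simpleReflections n) u v)
    (h2 : AbsLE (simpleReflections n) v w) : AbsLE (simpleReflections n) u w := by
  rw [absLE_iff] at *
  have h3 := movedRank_mul_le (u⁻¹ * v) (v⁻¹ * w)
  have h4 := movedRank_mul_le u (u⁻¹ * w)
  rw [mul_inv_cancel_left] at h4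
  rw [show u⁻¹ * v * (v⁻¹ * w) = u⁻¹ * w by group] at h3
  omega

theorem absLE_of_movedRank_lt {w : Hyperoctahedral n} {i j : SignedPoint n}
    (h : movedRank (w * refl i j) < movedRank w) :
    AbsLE (simpleReflections n) (w * refl i j) w ∧ movedRank w ≤ movedRank (w * refl i j) + 1 := by
  have h1 := movedRank_mul_le (w * refl i j) (refl i j)
  have h2 := movedRank_refl_le i j
  rw [mul_assoc, refl_mul_refl, mul_one] at h1
  refine ⟨?_, by omega⟩
  rw [absLE_iff, mul_inv_rev, refl_inv, inv_mul_cancel_right]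
  omega

theorem root_sub_mem_of_movedRank_lt {w : Hyperoctahedral n} {i j : SignedPoint n}
    (h : movedRank (w * refl i j) < movedRank w) : root j - root i ∈ moved w := by
  have h2 := movedRank_refl_le i j
  have h3 := moved_mul_eq (u := w * refl i j) (v := refl i j) (by
    rw [mul_assoc, refl_mul_refl, mul_one]
    omega)
  rw [mul_assoc, refl_mul_refl, mul_one] at h3
  rw [h3]
  have h4 := sub_mem_moved (refl i j) i
  rw [refl_apply_left] at h4
  exact Submodule.mem_sup_right h4

/-- A strict relation in the absolute order can be shortened by a reflection below the top. -/
theorem exists_absLE_mul_refl {u v : Hyperoctahedral n} (h : AbsLE (simpleReflections n) u v)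
    (hne : u ≠ v) : ∃ i j, i ≠ j ∧ root j - root i ∈ moved v ∧
      AbsLE (simpleReflections n) u (v * refl i j) ∧
      movedRank (v * refl i j) < movedRank v := by
  obtain ⟨i, j, hij, hm⟩ := exists_refl_of_ne_one (w := u⁻¹ * v) fun h' =>
    hne (inv_mul_eq_one.1 h')
  have h1 := movedRank_mul_refl_lt hij hm
  rw [absLE_iff] at h
  have h2 := movedRank_mul_le u (u⁻¹ * v * refl i j)
  rw [← mul_assoc, mul_inv_cancel_left] at h2
  have h3 : movedRank (v * refl i j) < movedRank v := by omega
  have h4 := (absLE_of_movedRank_lt h3).2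
  refine ⟨i, j, hij, root_sub_mem_of_movedRank_lt h3, ?_, h3⟩
  rw [absLE_iff, ← mul_assoc]
  omega

theorem refl_absLE_iff_mem {w : Hyperoctahedral n} {i j : SignedPoint n} (hij : i ≠ j) :
    AbsLE (simpleReflections n) (refl i j) w ↔ root j - root i ∈ moved w := by
  rw [absLE_iff, refl_inv]
  constructor
  · intro h
    have h3 := moved_mul_eq (u := refl i j) (v := refl i j * w) (by
      rw [← mul_assoc, refl_mul_refl, one_mul]
      omega)
    rw [← mul_assoc, refl_mul_refl, one_mul] at h3
    rw [h3]
    have h4 := sub_mem_moved (refl i j) i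
    rw [refl_apply_left] at h4
    exact Submodule.mem_sup_left h4
  · intro h
    have h1 := movedRank_refl_mul_lt hij h
    have h2 := movedRank_refl_le i j
    have h3 := movedRank_mul_le (refl i j) (refl i j * w)
    rw [← mul_assoc, refl_mul_refl, one_mul] at h3
    omega

theorem root_sub_mem_of_sameCycle {w : Hyperoctahedral n} {i j : SignedPoint n}
    (h : w.1.SameCycle i j) : root j - root i ∈ moved w := by
  obtain ⟨k, -, -, rfl⟩ := h.exists_pow_eq''
  clear h
  induction k with
  | zero => simp
  | succ k ih =>
    rw [pow_succ', Equiv.Perm.mul_apply]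
    have h1 := add_mem (sub_mem_moved w ((w.1 ^ k) i)) ih
    rwa [sub_add_sub_cancel] at h1

theorem root_sub_mem_moved_iff {w : Hyperoctahedral n} {i j : SignedPoint n} :
    root j - root i ∈ moved w ↔
      w.1.SameCycle i j ∨ (w.1.SameCycle i (bar i) ∧ w.1.SameCycle j (bar j)) := by
  classical
  constructor
  · intro h
    by_contra! hcon
    obtain ⟨h1, h2⟩ := hcon
    -- Test against the indicator of the cycle of k, which is invariant under w.
    have key : ∀ k, (if w.1.SameCycle k j then (1 : ℚ) else 0) -
        (if w.1.SameCycle k (bar j) then 1 else 0) -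
        ((if w.1.SameCycle k i then 1 else 0) -
          (if w.1.SameCycle k (bar i) then 1 else 0)) = 0 := by
      intro k
      have h3 := sum_mul_eq_zero_of_mem_moved
        (f := fun z => if w.1.SameCycle k z then (1 : ℚ) else 0)
        (fun x => by simp only [Equiv.Perm.sameCycle_apply_right]) h
      simp only [Pi.sub_apply, mul_sub, Finset.sum_sub_distrib] at h3
      rwa [sum_mul_root, sum_mul_root] at h3
    have hi := key i
    have hj := key j
    have h1' : ¬ w.1.SameCycle j i := fun h => h1 h.symm
    rw [if_neg h1, if_pos (Equiv.Perm.SameCycle.refl _ _)] at hi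
    rw [if_neg h1', if_pos (Equiv.Perm.SameCycle.refl _ _)] at hj
    have hib : w.1.SameCycle i (bar i) := by
      by_contra hb
      rw [if_neg hb] at hi
      split_ifs at hi <;> norm_num at hi
    have hjb := h2 hib
    rw [if_neg hjb] at hj
    split_ifs at hj <;> norm_num at hj
  · rintro (h | ⟨h1, h2⟩)
    · exact root_sub_mem_of_sameCycle h
    · have key : ∀ k, w.1.SameCycle k (bar k) → root k ∈ moved w := by
        intro k hk
        have h3 := root_sub_mem_of_sameCycle hk
        rw [root_bar] at h3
        have h4 : root k = (-1 / 2 : ℚ) • (-root k - root k) := by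
          ext z
          simp only [Pi.smul_apply, Pi.sub_apply, Pi.neg_apply, smul_eq_mul]
          ring
        rw [h4]
        exact Submodule.smul_mem _ _ h3
      exact sub_mem (key j h2) (key i h1)

theorem refl_absLE_iff {w : Hyperoctahedral n} {i j : SignedPoint n} (hij : i ≠ j) :
    AbsLE (simpleReflections n) (refl i j) w ↔
      w.1.SameCycle i j ∨ (w.1.SameCycle i (bar i) ∧ w.1.SameCycle j (bar j)) :=
  (refl_absLE_iff_mem hij).trans root_sub_mem_moved_iff

end Reflections

section Coxeter

variable {n : ℕ}

/-! ### Coxeter elements act as rotations of an even cycle -/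

theorem refl_comm (i j : SignedPoint n) : refl i j = refl j i := by
  refine hyperoctahedral_ext fun x => ?_
  rw [refl_apply, refl_apply]
  unfold reflFun
  have h : bar i = bar j ↔ i = j := bar_inj
  grind

/-- The neighbour of `(i, false)` across the edge of the path `-n, …, -1, 1, …, n` that is
exchanged by the simple reflection `i`. -/
def lowerEnd (i : Fin n) : SignedPoint n :=
  if (i : ℕ) = 0 then (i, true)
  else (⟨(i : ℕ) - 1, lt_of_le_of_lt (Nat.sub_le _ _) i.isLt⟩, false)

theorem simpleReflection_eq (i : Fin n) :
    simpleReflection i = refl (i, false) (lowerEnd i) := by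
  unfold simpleReflection lowerEnd
  split_ifs with h
  · exact signChange_eq i
  · rw [liftPerm_swap, refl_comm]

/-- The points `i, i + 1, …, n`, on one side of the edge exchanged by a simple reflection. -/
def IsAbove (i : Fin n) (x : SignedPoint n) : Prop := x.2 = false ∧ i ≤ x.1

/-- Only the simple reflection i exchanges points across the lower end of this segment of the path.
-/
theorem isAbove_simpleReflection {i j : Fin n} (hij : i ≠ j) (x : SignedPoint n) :
    IsAbove i ((simpleReflection j).1 x) ↔ IsAbove i x := by
  have hij' : (i : ℕ) ≠ j := fun h => hij (Fin.ext h)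
  rw [simpleReflection_eq, refl_apply, reflFun]
  unfold lowerEnd
  by_cases h0 : (j : ℕ) = 0
  · simp only [h0, if_true]
    split_ifs with h1 h2 h3 h4
    · subst h1
      simp only [IsAbove, Fin.le_def]
      simp
      omega
    · subst h2
      simp only [IsAbove, Fin.le_def]
      simp
      omega
    · subst h3
      simp only [IsAbove, bar, Fin.le_def]
      simp
      omega
    · subst h4
      simp only [IsAbove, bar, Fin.le_def]
      simp
      omega
    · rfl
  · simp only [h0, if_false]
    split_ifs with h1 h2 h3 h4
    · subst h1
      simp only [IsAbove, Fin.le_def]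
      simp
      omega
    · subst h2
      simp only [IsAbove, Fin.le_def]
      simp
      omega
    · subst h3
      simp [IsAbove, bar]
    · subst h4
      simp [IsAbove, bar]
    · rfl

theorem isAbove_self (i : Fin n) : IsAbove i (i, false) := ⟨rfl, le_rfl⟩

theorem simpleReflection_apply_of_isAbove {i : Fin n} {x : SignedPoint n} (hx : IsAbove i x)
    (hne : x ≠ (i, false)) : (simpleReflection i).1 x = x := by
  obtain ⟨h1, h2⟩ := hx
  rw [Fin.le_def] at h2
  rw [simpleReflection_eq]
  obtain ⟨k, b⟩ := x
  simp only at h1 h2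
  subst h1
  unfold lowerEnd
  apply refl_apply_of_ne hne
  · split_ifs with h0
    · simp
    · simp only [ne_eq, Prod.mk.injEq, and_true, Fin.ext_iff]
      omega
  · simp [bar]
  · split_ifs with h0
    · simpa [bar] using hne
    · simp [bar]

theorem isAbove_prod {i : Fin n} {l : List (Fin n)} (hi : i ∉ l) (x : SignedPoint n) :
    IsAbove i ((l.map simpleReflection).prod.1 x) ↔ IsAbove i x := by
  induction l with
  | nil => rfl
  | cons j l ih =>
    rw [List.mem_cons, not_or] at hi
    rw [List.map_cons, List.prod_cons, mul_apply, isAbove_simpleReflection hi.1, ih hi.2]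

/-- Sum over the points above i, a set preserved by u: f and f composed with the simple reflection
have the same sum there. They can differ only at `(i, false)`, the one point of the set that the
reflection moves. -/
theorem apply_lowerEnd_of_invariant {i : Fin n} {u : Hyperoctahedral n}
    (hu : ∀ x, IsAbove i (u.1 x) ↔ IsAbove i x) {f : SignedPoint n → ℚ}
    (hf : ∀ x, f ((simpleReflection i).1 (u.1 x)) = f x) : f (lowerEnd i) = f (i, false) := by
  classical
  have h1 : ∑ y, (if IsAbove i y then f ((simpleReflection i).1 y) else 0) =
      ∑ y, if IsAbove i y then f y else 0 := by
    rw [← Equiv.sum_comp u.1 fun y => if IsAbove i y then f ((simpleReflection i).1 y) else 0]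
    simp only [hu, hf]
  rw [← sub_eq_zero, ← Finset.sum_sub_distrib, Finset.sum_eq_single (i, false)] at h1
  · rw [if_pos (isAbove_self i), if_pos (isAbove_self i), simpleReflection_eq,
      refl_apply_left, sub_eq_zero] at h1
    exact h1
  · intro y _ hy
    split_ifs with h
    · rw [simpleReflection_apply_of_isAbove h hy, sub_self]
    · rw [sub_self]
  · simp

theorem apply_simpleReflection_of_invariant {l : List (Fin n)} (hl : l.Nodup)
    {f : SignedPoint n → ℚ} (hf : ∀ x, f ((l.map simpleReflection).prod.1 x) = f x) :
    ∀ i ∈ l, ∀ x, f ((simpleReflection i).1 x) = f x := by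
  induction l with
  | nil => simp
  | cons i l ih =>
    rw [List.nodup_cons] at hl
    simp only [List.map_cons, List.prod_cons, mul_apply] at hf
    have h1 := apply_lowerEnd_of_invariant (isAbove_prod hl.1) hf
    have h2 := apply_lowerEnd_of_invariant (f := fun x => f (bar x)) (isAbove_prod hl.1)
      fun x => by rw [← apply_bar, ← apply_bar, hf]
    have h3 : ∀ x, f ((simpleReflection i).1 x) = f x := by
      intro x
      rw [simpleReflection_eq, refl_apply, reflFun]
      split_ifs with e1 e2 e3 e4
      · rw [h1, e1]
      · rw [← h1, e2]
      · rw [e3]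
        exact h2
      · rw [e4]
        exact h2.symm
      · rfl
    intro j hj
    rcases List.mem_cons.1 hj with rfl | hj
    · exact h3
    · refine ih hl.2 (fun x => ?_) j hj
      rw [← hf x, h3]

theorem eq_of_invariant {f : SignedPoint n → ℚ}
    (hf : ∀ i x, f ((simpleReflection i).1 x) = f x) (x y : SignedPoint n) : f x = f y := by
  have hn : 0 < n := lt_of_le_of_lt (Nat.zero_le _) x.1.isLt
  have hbase : f (⟨0, hn⟩, true) = f (⟨0, hn⟩, false) := by
    have h := hf ⟨0, hn⟩ (⟨0, hn⟩, false)
    rwa [simpleReflection_eq, refl_apply_left] at h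
  have key : ∀ k (hk : k < n), f (⟨k, hk⟩, false) = f (⟨0, hn⟩, false) ∧
      f (⟨k, hk⟩, true) = f (⟨0, hn⟩, false) := by
    intro k
    induction k with
    | zero => exact fun _ => ⟨rfl, hbase⟩
    | succ k ih =>
      intro hk
      obtain ⟨h1, h2⟩ := ih (by omega)
      have hl : lowerEnd (⟨k + 1, hk⟩ : Fin n) = (⟨k, by omega⟩, false) := by
        simp [lowerEnd]
      have h3 := hf ⟨k + 1, hk⟩ (⟨k + 1, hk⟩, false)
      have h4 := hf ⟨k + 1, hk⟩ (bar (⟨k + 1, hk⟩, false))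
      rw [apply_bar] at h4
      rw [simpleReflection_eq, refl_apply_left, hl] at h3 h4
      exact ⟨h3 ▸ h1, by rw [← h2]; exact h4.symm⟩
  have key' : ∀ z : SignedPoint n, f z = f (⟨0, hn⟩, false) := by
    rintro ⟨⟨k, hk⟩, b⟩
    cases b
    · exact (key k hk).1
    · exact (key k hk).2
  rw [key' x, key' y]

/-- The indicator of a cycle of c is invariant under c, hence under each simple reflection by
peeling off factors, hence constant. -/
theorem IsCoxeterElement.sameCycle {c : Hyperoctahedral n} (hc : IsCoxeterElement c)
    (x y : SignedPoint n) : c.1.SameCycle x y := by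
  classical
  obtain ⟨σ, rfl⟩ := hc
  set c := (List.ofFn fun i => simpleReflection (σ i)).prod with hcdef
  have hlist : c = ((List.ofFn σ).map simpleReflection).prod := by
    rw [hcdef, List.map_ofFn]
    rfl
  let f : SignedPoint n → ℚ := fun z => if c.1.SameCycle x z then 1 else 0
  have hf : ∀ z, f (c.1 z) = f z := fun z => by
    simp only [f, Equiv.Perm.sameCycle_apply_right]
  have hs := apply_simpleReflection_of_invariant (f := f)
    (List.nodup_ofFn.2 σ.injective) (by rwa [← hlist])
  have hxy := eq_of_invariant (f := f)
    (fun i => hs i (List.mem_ofFn.2 ⟨σ.symm i, σ.apply_symm_apply i⟩)) x y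
  by_contra hcon
  simp only [f, if_neg hcon, if_pos (Equiv.Perm.SameCycle.refl c.1 x)] at hxy
  norm_num at hxy

/-- A Coxeter element identifies the signed points with an even cycle, on which it acts as the
rotation by one step and `bar` as the rotation by one half turn. -/
theorem IsCoxeterElement.exists_equiv {c : Hyperoctahedral n} (hc : IsCoxeterElement c)
    (hn : 0 < n) :
    ∃ e : SignedPoint n ≃ ZMod (2 * n), (∀ x, e (c.1 x) = e x + 1) ∧
      ∀ x, e (bar x) = e x + (n : ZMod (2 * n)) := by
  have : NeZero (2 * n) := ⟨by omega⟩
  have hcard : (Finset.univ : Finset (SignedPoint n)).card = 2 * n := by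
    rw [Finset.card_univ, Fintype.card_prod, Fintype.card_fin, Fintype.card_bool, mul_comm]
  let o : SignedPoint n := (⟨0, hn⟩, false)
  have hcyc : c.1.IsCycleOn (Finset.univ : Finset (SignedPoint n)) :=
    ⟨by simp, fun x _ y _ => hc.sameCycle x y⟩
  let g : ZMod (2 * n) → SignedPoint n := fun k => (c.1 ^ k.val) o
  have hg : ∀ j : ℕ, (c.1 ^ j) o = g (j : ZMod (2 * n)) := by
    intro j
    have h1 : (c.1 ^ (2 * n)) o = o := by
      rw [← hcard]
      exact hcyc.pow_card_apply (Finset.mem_univ _)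
    have h2 : ∀ q, ((c.1 ^ (2 * n)) ^ q) o = o := fun q => by
      rw [← Equiv.Perm.iterate_eq_pow, Function.iterate_fixed h1]
    simp only [g, ZMod.val_natCast]
    conv_lhs => rw [← Nat.mod_add_div j (2 * n), pow_add, pow_mul, Equiv.Perm.mul_apply, h2]
  have hg' : ∀ (j : ℕ) k, (c.1 ^ j) (g k) = g (k + j) := by
    intro j k
    have h1 : g k = (c.1 ^ k.val) o := rfl
    rw [h1, ← Equiv.Perm.mul_apply, ← pow_add, hg]
    congr 1
    push_cast
    rw [ZMod.natCast_zmod_val, add_comm]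
  have hsurj : Function.Surjective g := by
    intro y
    obtain ⟨j, -, hj⟩ := hcyc.exists_pow_eq (Finset.mem_univ o) (Finset.mem_univ y)
    exact ⟨j, by rw [← hg, hj]⟩
  have hbij : Function.Bijective g := by
    rw [Fintype.bijective_iff_surjective_and_card]
    refine ⟨hsurj, ?_⟩
    rw [ZMod.card, ← hcard, Finset.card_univ]
  let e := (Equiv.ofBijective g hbij).symm
  have hge : ∀ x, g (e x) = x := fun x => (Equiv.ofBijective g hbij).apply_symm_apply x
  have heg : ∀ k, e (g k) = k := fun k => (Equiv.ofBijective g hbij).symm_apply_apply k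
  -- Commuting with c makes `bar` a translation by some m; it is an involution without fixed points,
  -- so m = n.
  obtain ⟨m, hm⟩ := hsurj (bar o)
  have hpowbar : ∀ (j : ℕ) x, (c.1 ^ j) (bar x) = bar ((c.1 ^ j) x) := by
    intro j x
    exact (c ^ j).2 x
  have hbar : ∀ k, bar (g k) = g (k + m) := by
    intro k
    have h1 : g k = (c.1 ^ k.val) o := rfl
    rw [h1, ← hpowbar, ← hm, hg', ZMod.natCast_zmod_val, add_comm]
  have hg0 : g 0 = o := by simp [g]
  have hm2 : m + m = 0 := by
    have h1 := hbar m
    rw [hm, bar_bar, ← hg0] at h1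
    exact (hbij.1 h1).symm
  have hm0 : m ≠ 0 := by
    rintro rfl
    rw [hg0] at hm
    exact bar_ne o hm.symm
  have hmn : m = (n : ZMod (2 * n)) := by
    have h1 := ZMod.val_lt m
    have h2 : m.val ≠ 0 := fun h => hm0 ((ZMod.val_eq_zero m).1 h)
    have h3 := ZMod.val_add m m
    rw [hm2, ZMod.val_zero] at h3
    have h4 : 2 * n ∣ m.val + m.val := Nat.dvd_of_mod_eq_zero h3.symm
    obtain ⟨q, hq⟩ := h4
    have h5 : q = 1 := by
      have hq0 : q ≠ 0 := by rintro rfl; omega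
      have hq2 : q < 2 := by
        by_contra hge2
        have : 2 * n * 2 ≤ 2 * n * q := Nat.mul_le_mul_left _ (by omega)
        omega
      omega
    rw [h5] at hq
    rw [← ZMod.natCast_zmod_val m]
    congr 1
    omega
  refine ⟨e, fun x => ?_, fun x => ?_⟩
  · have h1 := hg' 1 (e x)
    rw [hge, pow_one, Nat.cast_one] at h1
    rw [h1, heg]
  · have h1 := hbar (e x)
    rw [hge] at h1
    rw [h1, heg, hmn]

end Coxeter

section Projection

variable {n N : ℕ} [NeZero N]

/-! ### Noncrossing partitions of the hyperoctahedral group -/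

/-- The permutation of the cycle induced by a signed permutation. -/
def toCycle (e : SignedPoint n ≃ ZMod N) (w : Hyperoctahedral n) : Equiv.Perm (ZMod N) :=
  e.permCongr w.1

theorem toCycle_apply (e : SignedPoint n ≃ ZMod N) (w : Hyperoctahedral n) (x : SignedPoint n) :
    toCycle e w (e x) = e (w.1 x) := by
  simp [toCycle, Equiv.permCongr_apply]

theorem toCycle_mul (e : SignedPoint n ≃ ZMod N) (u v : Hyperoctahedral n) :
    toCycle e (u * v) = toCycle e u * toCycle e v := by
  refine Equiv.ext fun x => ?_
  obtain ⟨x, rfl⟩ := e.surjective x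
  rw [Equiv.Perm.mul_apply, toCycle_apply, toCycle_apply, toCycle_apply, mul_apply]

theorem toCycle_one (e : SignedPoint n ≃ ZMod N) : toCycle e 1 = 1 := by
  refine Equiv.ext fun x => ?_
  obtain ⟨x, rfl⟩ := e.surjective x
  rw [toCycle_apply]
  rfl

theorem toCycle_inv (e : SignedPoint n ≃ ZMod N) (u : Hyperoctahedral n) :
    toCycle e u⁻¹ = (toCycle e u)⁻¹ :=
  eq_inv_of_mul_eq_one_left (by rw [← toCycle_mul, inv_mul_cancel, toCycle_one])

theorem toCycle_injective (e : SignedPoint n ≃ ZMod N) : Function.Injective (toCycle e) := by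
  intro u v h
  refine hyperoctahedral_ext fun x => e.injective ?_
  rw [← toCycle_apply, h, toCycle_apply]

theorem toCycle_pow (e : SignedPoint n ≃ ZMod N) (w : Hyperoctahedral n) (k : ℕ)
    (x : SignedPoint n) : (toCycle e w ^ k) (e x) = e ((w.1 ^ k) x) := by
  induction k with
  | zero => rfl
  | succ k ih =>
    rw [pow_succ', pow_succ', Equiv.Perm.mul_apply, Equiv.Perm.mul_apply, ih, toCycle_apply]

theorem sameCycle_toCycle {e : SignedPoint n ≃ ZMod N} {w : Hyperoctahedral n}
    {x y : SignedPoint n} : (toCycle e w).SameCycle (e x) (e y) ↔ w.1.SameCycle x y := by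
  constructor
  · intro h
    obtain ⟨k, -, -, hk⟩ := h.exists_pow_eq''
    rw [toCycle_pow] at hk
    exact ⟨k, by rw [zpow_natCast]; exact e.injective hk⟩
  · intro h
    obtain ⟨k, -, -, rfl⟩ := h.exists_pow_eq''
    exact ⟨k, by rw [zpow_natCast, toCycle_pow]⟩

theorem symPerm_toCycle {e : SignedPoint n ≃ ZMod N}
    (he : ∀ x, e (bar x) = e x + (n : ZMod N)) (w : Hyperoctahedral n) :
    SymPerm n (toCycle e w) := by
  intro x
  obtain ⟨x, rfl⟩ := e.surjective x
  rw [← he, toCycle_apply, toCycle_apply, apply_bar, he]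

theorem exists_toCycle_eq {e : SignedPoint n ≃ ZMod N}
    (he : ∀ x, e (bar x) = e x + (n : ZMod N)) {u : Equiv.Perm (ZMod N)} (hu : SymPerm n u) :
    ∃ w : Hyperoctahedral n, toCycle e w = u := by
  refine ⟨⟨e.symm.permCongr u, fun x => ?_⟩, ?_⟩
  · simp only [Equiv.permCongr_apply, Equiv.symm_symm]
    rw [Equiv.symm_apply_eq, he, hu, he, Equiv.apply_symm_apply]
  · refine Equiv.ext fun x => ?_
    simp [toCycle, Equiv.permCongr_apply]

/-- The signed permutation `v` is the cyclic successor permutation of a symmetric noncrossing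
equivalence relation. -/
structure IsNext (e : SignedPoint n ≃ ZMod N) (r : Setoid (ZMod N)) (v : Hyperoctahedral n) :
    Prop where
  nc : NC r
  sym : Sym n r
  eq : toCycle e v = nxt r

theorem IsNext.sameCycle_iff {e : SignedPoint n ≃ ZMod N} {r : Setoid (ZMod N)}
    {v : Hyperoctahedral n} (h : IsNext e r v) {x y : SignedPoint n} :
    v.1.SameCycle x y ↔ r (e x) (e y) := by
  rw [← sameCycle_toCycle (e := e), h.eq, sameCycle_nxt]

/-- A symmetric noncrossing relation has at most one symmetric class. -/
theorem rel_of_symmetric (hN : N = 2 * n) {r : Setoid (ZMod N)} (hr : NC r) {x y : ZMod N}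
    (hx : r x (x + n)) (hy : r y (y + n)) : r x y := by
  by_contra hxy
  rcases exists_not_symmetric hN hr hxy with h | h
  · exact h hx
  · exact h hy

/-- The moved space also joins distinct cycles that are closed under `bar`; a noncrossing relation
must relate these anyway, since antipodal pairs cross. -/
theorem rel_of_root_sub_mem (hN : N = 2 * n) {e : SignedPoint n ≃ ZMod N}
    (he : ∀ x, e (bar x) = e x + (n : ZMod N)) {r : Setoid (ZMod N)} (hr : NC r)
    {w : Hyperoctahedral n} (hw : ∀ x y, w.1.SameCycle x y → r (e x) (e y))
    {i j : SignedPoint n} (h : root j - root i ∈ moved w) : r (e i) (e j) := by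
  rcases root_sub_mem_moved_iff.1 h with h | ⟨h1, h2⟩
  · exact hw _ _ h
  · have h1' := hw _ _ h1
    have h2' := hw _ _ h2
    rw [he] at h1' h2'
    exact rel_of_symmetric hN hr h1' h2'

/-- The symmetric refinement of an equivalence relation along an arc and its opposite. -/
def symCut (n : ℕ) (r : Setoid (ZMod N)) (a b : ZMod N) : Setoid (ZMod N) :=
  r ⊓ cut a b ⊓ cut (a + n) (b + n)

theorem cut_add {a b x y m : ZMod N} : cut (a + m) (b + m) (x + m) (y + m) ↔ cut a b x y := by
  rw [cut_iff, cut_iff, cd_add_right, cd_add_right, cd_add_right]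

theorem toCycle_refl_of_eq {e : SignedPoint n ≃ ZMod N} {i j : SignedPoint n} (h : j = bar i) :
    toCycle e (refl i j) = Equiv.swap (e i) (e j) := by
  refine Equiv.ext fun x => ?_
  obtain ⟨x, rfl⟩ := e.surjective x
  subst h
  rw [toCycle_apply, refl_apply, reflFun, Equiv.swap_apply_def]
  simp only [EmbeddingLike.apply_eq_iff_eq, bar_bar]
  split_ifs <;> rfl

theorem toCycle_refl_of_ne {e : SignedPoint n ≃ ZMod N} {i j : SignedPoint n} (h : j ≠ bar i) :
    toCycle e (refl i j) = Equiv.swap (e i) (e j) * Equiv.swap (e (bar i)) (e (bar j)) := by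
  refine Equiv.ext fun x => ?_
  obtain ⟨x, rfl⟩ := e.surjective x
  have h1 := bar_ne i
  have h2 := bar_ne j
  have h3 : bar i = j ↔ i = bar j := bar_eq_iff
  have h4 : bar i = bar j ↔ i = j := bar_inj
  rw [toCycle_apply, refl_apply, reflFun, Equiv.Perm.mul_apply]
  simp only [Equiv.swap_apply_def, EmbeddingLike.apply_eq_iff_eq]
  grind [EmbeddingLike.apply_eq_iff_eq]

theorem IsNext.mul_refl (hN : N = 2 * n) {e : SignedPoint n ≃ ZMod N}
    (he : ∀ x, e (bar x) = e x + (n : ZMod N)) {r : Setoid (ZMod N)} {v : Hyperoctahedral n}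
    (h : IsNext e r v) {i j : SignedPoint n} (hij : i ≠ j) (hr : r (e i) (e j)) :
    IsNext e (symCut n r (e i) (e j)) (v * refl i j) := by
  have hne : e i ≠ e j := fun h => hij (e.injective h)
  refine ⟨(h.nc.inf (NC_cut _ _)).inf (NC_cut _ _), ?_, ?_⟩
  · rintro x y ⟨⟨h1, h2⟩, h3⟩
    refine ⟨⟨h.sym _ _ h1, ?_⟩, cut_add.2 h2⟩
    rw [← cut_add (m := (n : ZMod N)), add_assoc, add_assoc, half_add_half hN, add_zero,
      add_zero]
    exact h3
  · rw [toCycle_mul, h.eq]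
    have hij0 : cd (e i) (e j) ≠ 0 := fun h => hne (cd_eq_zero.1 h)
    have hi := cd_half hN (e i)
    have hj := cd_half hN (e j)
    rw [cd_base (e i) (e j) (e j + n)] at hj
    have hjl := cd_lt (e i) (e j)
    have hjl' := cd_lt (e i) (e j + n)
    by_cases hb : j = bar i
    -- The chord is a diameter, so its opposite cut is the same cut with the two sides exchanged.
    · rw [toCycle_refl_of_eq hb, nxt_mul_swap h.nc hr hne]
      congr 1
      refine le_antisymm (le_inf le_rfl (inf_le_right.trans ?_)) inf_le_left
      have hji : e j = e i + n := by rw [hb, he]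
      intro x y hxy
      rw [cut_iff] at hxy ⊢
      rw [hji, cd_add_right, cd_base (e i) (e i + n) x, cd_base (e i) (e i + n) y, hi]
      rw [hji, hi] at hxy
      have := cd_lt (e i) x
      have := cd_lt (e i) y
      have := cd_half hN (e i)
      split_ifs <;> omega
    · have hbn : cd (e i) (e j) ≠ n := fun h' => by
        have h1 := (cd_right_inj _).1 (h'.trans hi.symm)
        rw [← he] at h1
        exact hb (e.injective h1)
      have hne' : e i + (n : ZMod N) ≠ e j + n := fun h => hne (add_right_cancel h)
      -- Two successive splittings: the ends of the opposite chord lie on the same side of the first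
      -- cut, so they are still related after it.
      rw [toCycle_refl_of_ne hb, he, he, ← mul_assoc, nxt_mul_swap h.nc hr hne,
        nxt_mul_swap (h.nc.inf (NC_cut _ _)) ⟨h.sym _ _ hr, ?_⟩ hne']
      · rfl
      · rw [cut_iff, hi]
        split_ifs at hj <;> omega

/-- Descend from v to u by reflections below the current element, each of which cuts a class along a
chord. Applied to v = c, this describes all of NC(B_n, c). -/
theorem IsNext.of_absLE (hN : N = 2 * n) {e : SignedPoint n ≃ ZMod N}
    (he : ∀ x, e (bar x) = e x + (n : ZMod N)) {r : Setoid (ZMod N)} {u v : Hyperoctahedral n}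
    (h : IsNext e r v) (huv : AbsLE (simpleReflections n) u v) : ∃ s, IsNext e s u := by
  induction hk : movedRank v using Nat.strong_induction_on generalizing v r with
  | _ k ih =>
    by_cases hne : u = v
    · exact ⟨r, hne ▸ h⟩
    · obtain ⟨i, j, hij, hm, hle, hlt⟩ := exists_absLE_mul_refl huv hne
      have hr := rel_of_root_sub_mem hN he h.nc (fun x y hxy => h.sameCycle_iff.1 hxy) hm
      exact ih _ (hk ▸ hlt) (h.mul_refl hN he hij hr) hle rfl

/-- If `r` refines `s` and the successor of `a` for `r` is preceded by `j` for `s`, then `r` refines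
the cut of `s` along the arc `(a, j]`. -/
theorem le_cut_of_le {r s : Setoid (ZMod N)} (hr : NC r) (hs : NC s) (hrs : r ≤ s)
    {a j : ZMod N} (hj : next s j = next r a) (haj : j ≠ a) : r ≤ cut a j := by
  set b := next r a with hb
  have hab : r a b := rel_next r a
  have hjb : s j b := hj ▸ rel_next s j
  have hsaj : s a j := s.trans' (hrs hab) (s.symm' hjb)
  have hja := le_cd_of_rel (s.symm' hsaj) haj.symm
  rw [hj] at hja
  have haj0 : cd a j ≠ 0 := fun h => haj (cd_eq_zero.1 h).symm
  have key : ∀ x y, r x y → 0 < cd a x → cd a x ≤ cd a j →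
      ¬ (0 < cd a y ∧ cd a y ≤ cd a j) → False := by
    intro x y hxy hx0 hxj hy
    have hyl := cd_lt a y
    have hxl := cd_lt a x
    have hjl := cd_lt a j
    have hbl := cd_lt a b
    have hxa : x ≠ a := fun h => by
      rw [h, cd_self] at hx0
      omega
    rw [cd_base a j b, cd_base a j a, cd_self] at hja
    have hnax : ¬ r a x := by
      intro hax
      have h1 := (le_cd_of_rel hax hxa).1
      rw [← hb] at h1
      have h2 : cd a b ≠ 0 := by
        have := (le_cd_of_rel hax hxa).2
        rw [← hb] at this
        omega
      split_ifs at hja <;> omega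
    have hy0 : cd a y ≠ 0 := fun h => by
      rw [← cd_eq_zero.1 h] at hxy
      exact hnax (r.symm' hxy)
    have hyb : cd a y ≠ cd a b := fun h => by
      rw [(cd_right_inj a).1 h] at hxy
      exact hnax (r.trans' hab (r.symm' hxy))
    -- If x is in the s-class of a, then so is y; no point of that class lies between j and b, so y
    -- lies past b and the pair x, y crosses a, b in r. Otherwise x, y crosses a, j in s.
    by_cases hsx : s a x
    · have hsy : s j y := s.trans' (s.symm' hsaj) (s.trans' hsx (hrs hxy))
      have hyj : y ≠ j := fun h => by
        rw [h] at hy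
        omega
      have h1 := (le_cd_of_rel hsy hyj).1
      rw [hj, cd_base a j b, cd_base a j y] at h1
      have h2 := hr a x b y hx0
      by_cases hlt : cd a x < cd a b ∧ cd a b < cd a y
      · exact hnax (h2 hlt.1 hlt.2 hab hxy)
      · split_ifs at hja h1 <;> omega
    · have hxj' : cd a x ≠ cd a j := fun h => hsx (by rw [(cd_right_inj a).1 h]; exact hsaj)
      exact hsx (hs a x j y hx0 (by omega) (by omega) hsaj (hrs hxy))
  intro x y hxy
  rw [cut_iff]
  constructor
  · intro hx
    by_contra hy
    exact key x y hxy hx.1 hx.2 hy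
  · intro hy
    by_contra hx
    exact key y x (r.symm' hxy) hy.1 hy.2 hx

/-- As long as u ≠ v, some chord cuts s into a symmetric noncrossing relation that r still refines;
the cut lowers v by a reflection, and induction on the rank applies. The chord joins a point a whose
successors differ to the s-predecessor j of its r-successor. -/
theorem IsNext.absLE (hN : N = 2 * n) {e : SignedPoint n ≃ ZMod N}
    (he : ∀ x, e (bar x) = e x + (n : ZMod N)) {r s : Setoid (ZMod N)} {u v : Hyperoctahedral n}
    (hu : IsNext e r u) (hv : IsNext e s v) (hrs : r ≤ s) : AbsLE (simpleReflections n) u v := by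
  induction hk : movedRank v using Nat.strong_induction_on generalizing v s with
  | _ k ih =>
    by_cases hne : u = v
    · rw [hne]
      exact absLE_refl v
    · have hex : ∃ a, next r a ≠ next s a := by
        by_contra! hcon
        refine hne (toCycle_injective e ?_)
        rw [hu.eq, hv.eq]
        exact Equiv.ext hcon
      obtain ⟨a, ha⟩ := hex
      obtain ⟨j, hj⟩ := (nxt s).surjective (next r a)
      rw [nxt_apply] at hj
      have hja : j ≠ a := by
        rintro rfl
        exact ha hj.symm
      have hcut := le_cut_of_le hu.nc hv.nc hrs hj hja
      have hsaj : s a j := s.trans' (hrs (rel_next r a)) (s.symm' (hj ▸ rel_next s j))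
      obtain ⟨a, rfl⟩ := e.surjective a
      obtain ⟨j, rfl⟩ := e.surjective j
      have haj : a ≠ j := fun h => hja (by rw [h])
      have hlt := movedRank_mul_refl_lt haj
        (root_sub_mem_of_sameCycle (hv.sameCycle_iff.2 hsaj))
      have hle : r ≤ symCut n s (e a) (e j) := by
        refine le_inf (le_inf hrs hcut) fun x y hxy => ?_
        have h1 := hcut (hu.sym _ _ hxy)
        rw [← cut_add (m := (n : ZMod N)), add_assoc x, add_assoc y, half_add_half hN,
          add_zero, add_zero] at h1
        exact h1
      exact absLE_trans (ih _ (hk ▸ hlt) (hv.mul_refl hN he haj hsaj) hle rfl)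
        (absLE_of_movedRank_lt hlt).1

/-! ### The noncrossing projection -/

theorem ncProj_eq_of_isNCJoin {c w v : Hyperoctahedral n}
    (h : IsNCJoin (simpleReflections n) c (reflectionsBelow (simpleReflections n) w) v) :
    ncProj (simpleReflections n) c w = v := by
  have hex : ∃ v, IsNCJoin (simpleReflections n) c
      (reflectionsBelow (simpleReflections n) w) v := ⟨v, h⟩
  rw [ncProj, dif_pos hex]
  have h' := hex.choose_spec
  exact absLE_antisymm (h'.2.2 _ h.1 h.2.1) (h.2.2 _ h'.1 h'.2.1)

/-- Every reflection below w relates points of one class of the closure, which gives an upper bound.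
Conversely, an upper bound u in NC(B_n, c) lies above each `refl x (w.1 x)` with x moved, so its
noncrossing relation contains the cycles of w and hence their closure. -/
theorem toCycle_ncProj (hN : N = 2 * n) {e : SignedPoint n ≃ ZMod N}
    (he : ∀ x, e (bar x) = e x + (n : ZMod N)) {c : Hyperoctahedral n}
    (hc : ∀ x, e (c.1 x) = e x + 1) (w : Hyperoctahedral n) :
    toCycle e (ncProj (simpleReflections n) c w) = nxt (ncOrbits (toCycle e w)) := by
  have hcn : IsNext e (block Set.univ) c := by
    refine ⟨NC_block _, sym_block fun _ _ => trivial, ?_⟩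
    rw [← rot_eq_nxt_top]
    refine Equiv.ext fun x => ?_
    obtain ⟨x, rfl⟩ := e.surjective x
    rw [toCycle_apply, hc, rot_apply]
  have hsym := (symPerm_toCycle he w).ncOrbits
  obtain ⟨v, hv⟩ := exists_toCycle_eq he (hsym.nxt hN)
  have hvn : IsNext e (ncOrbits (toCycle e w)) v := ⟨NC_ncOrbits _, hsym, hv⟩
  suffices h : IsNCJoin (simpleReflections n) c (reflectionsBelow (simpleReflections n) w) v by
    rw [ncProj_eq_of_isNCJoin h, hv]
  refine ⟨⟨one_absLE v, hvn.absLE hN he hcn fun _ _ _ => Or.inr ⟨trivial, trivial⟩⟩, ?_, ?_⟩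
  · rintro t ⟨ht, htw⟩
    obtain ⟨i, j, hij, rfl⟩ := mem_reflections_iff.1 ht
    rw [refl_absLE_iff_mem hij] at htw
    refine (refl_absLE_iff hij).2 (Or.inl (hvn.sameCycle_iff.2 ?_))
    exact rel_of_root_sub_mem hN he (NC_ncOrbits _)
      (fun x y hxy => le_ncClosure (Equiv.Perm.SameCycle.setoid (toCycle e w))
        (sameCycle_toCycle.2 hxy)) htw
  · rintro u ⟨-, huc⟩ hub
    obtain ⟨s, hs⟩ := hcn.of_absLE hN he huc
    refine hvn.absLE hN he hs (ncOrbits_le hs.nc fun x => ?_)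
    obtain ⟨x, rfl⟩ := e.surjective x
    rw [toCycle_apply]
    by_cases hx : x = w.1 x
    · rw [← hx]
    · have h1 := hub (refl x (w.1 x)) ⟨mem_reflections_iff.2 ⟨_, _, hx, rfl⟩,
        (refl_absLE_iff_mem hx).2 (sub_mem_moved w x)⟩
      rw [refl_absLE_iff_mem hx] at h1
      exact rel_of_root_sub_mem hN he hs.nc (fun x y hxy => hs.sameCycle_iff.1 hxy) h1

theorem toCycle_popT_iterate (hN : N = 2 * n) {e : SignedPoint n ≃ ZMod N}
    (he : ∀ x, e (bar x) = e x + (n : ZMod N)) {c : Hyperoctahedral n}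
    (hc : ∀ x, e (c.1 x) = e x + 1) (w : Hyperoctahedral n) (m : ℕ) :
    toCycle e ((popT (simpleReflections n) c)^[m] w) = popZ^[m] (toCycle e w) := by
  induction m generalizing w with
  | zero => rfl
  | succ m ih =>
    rw [Function.iterate_succ_apply, Function.iterate_succ_apply, ih, popT, toCycle_mul,
      toCycle_inv, toCycle_ncProj hN he hc, popZ]

theorem requiresExactly_iff (hN : N = 2 * n) {e : SignedPoint n ≃ ZMod N}
    (he : ∀ x, e (bar x) = e x + (n : ZMod N)) {c : Hyperoctahedral n}
    (hc : ∀ x, e (c.1 x) = e x + 1) (w : Hyperoctahedral n) (k : ℕ) :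
    RequiresExactly (simpleReflections n) c w k ↔
      IsLeast {m : ℕ | popZ^[m] (toCycle e w) = 1} k := by
  have h : ∀ m, (popT (simpleReflections n) c)^[m] w = 1 ↔ popZ^[m] (toCycle e w) = 1 := by
    intro m
    rw [← toCycle_popT_iterate hN he hc, ← toCycle_one e]
    exact (toCycle_injective e).eq_iff.symm
  rw [RequiresExactly]
  simp only [h]

end Projection

end PopTsack

/-! ### Transfer of the count to the hyperoctahedral group -/

theorem mainTheorem5 (n : ℕ) (hn : 2 ≤ n) (c : PopTsack.Hyperoctahedral n)
    (hc : PopTsack.IsCoxeterElement c) :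
    Set.ncard {w : PopTsack.Hyperoctahedral n |
      PopTsack.RequiresExactly (PopTsack.simpleReflections n) c w (2 * n - 2) ∨
        PopTsack.RequiresExactly (PopTsack.simpleReflections n) c w (2 * n - 1)} = 2 ^ n - n := by
  obtain ⟨e, hec, heb⟩ := hc.exists_equiv (by omega)
  have : NeZero (2 * n) := ⟨by omega⟩
  rw [← PopTsack.ncard_slow hn rfl,
    ← Set.ncard_image_of_injective _ (PopTsack.toCycle_injective e)]
  congr 1
  ext u
  simp only [Set.mem_image, Set.mem_ofPred_eq, PopTsack.requiresExactly_iff rfl heb hec,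
    PopTsack.isLeast_iterate_iff (show 3 ≤ 2 * n by omega)]
  constructor
  · rintro ⟨w, hw, rfl⟩
    exact ⟨PopTsack.symPerm_toCycle heb w, hw⟩
  · rintro ⟨hu, hne⟩
    obtain ⟨w, rfl⟩ := PopTsack.exists_toCycle_eq heb hu
    exact ⟨w, hne, rfl⟩
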